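/- Let $Q_d$ be the $d$-dimensional hypercube: its $2^d$ vertices are the vectors in $\{0,1\}^d$, two being adjacent iff they differ in exactly one coordinate. A labelling scheme with labels of size $s$ for a specific finite graph $G$ on $n$ vertices consists of a deterministic decoder $\mathcal D:\{0,1\}^s\times\{0,1\}^s\to\{0,1\}$ and a probability distribution $L_G$ over labelling functions $\ell:V(G)\to\{0,1\}^s$ (both may depend on $G$). It is an adjacency sketch with error $\delta$ if $\Pr_{\ell\sim L_G}[\mathcal D(\ell(u),\ell(v))=\mathbf 1_{(u,v)\in E(G)}]\ge 1-\delta$ for all $u,v\in V(G)$, and it only errs on non-edges if, with probability $1$ over $\ell\sim L_G$, $\mathcal D(\ell(u),\ell(v))=1$ for every edge $(u,v)$. It is adversarially resilient with probability of forgery $\varepsilon$ if every (computationally unbounded, possibly randomized) adversary wins the following game with probability at most $\varepsilon$: $\ell\sim L_G$ is drawn; the adversary adaptively asks for the labels of vertices $x_1,\dots,x_k$, where $k\le n-2$ need not be fixed in advance; it then declares two distinct vertices $x_{k+1},x_{k+2}$ that were not asked for, and wins iff $\mathcal D(\ell(x_{k+1}),\ell(x_{k+2}))\ne\mathbf 1_{(x_{k+1},x_{k+2})\in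 E(G)}$. The optimal size of adversarially resilient labels for $Q_d$ is $\Theta(\sqrt d)$. That is: 1. (Upper bound.) For all $\delta,\varepsilon>0$ there is a constant $C>0$, depending only on $\delta$ and $\varepsilon$, such that for every $d\ge 0$ the hypercube $Q_d$ has a labelling scheme with labels of some size $s\le C\sqrt d$ which is an adjacency sketch with error $\delta$, only errs on non-edges, and is adversarially resilient with probability of forgery $\varepsilon$. 2. (Lower bound.) For every $\varepsilon<1$ there is a constant $c>0$, depending only on $\varepsilon$, such that for every $\delta<1$ and every $d\ge 0$, every labelling scheme for $Q_d$ which is an adjacency sketch with error $\delta$, only errs on non-edges, and is adversarially resilient with probability of forgery $\varepsilon$, has labels of size $s\ge c\sqrt d$. -/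

import Mathlib

open scoped ENNReal

/-- Bit strings of length `s`: the labels of size `s`. -/
abbrev Label (s : ℕ) : Type := Fin s → Bool

/-- The `d`-dimensional hypercube: its `2 ^ d` vertices are the bit vectors of length `d`, and two
of them are adjacent iff they differ in exactly one coordinate. -/
def hypercube (d : ℕ) : SimpleGraph (Fin d → Bool) where
  Adj u v := hammingDist u v = 1
  symm := ⟨fun u v h => by rw [hammingDist_comm]; exact h⟩
  loopless := ⟨fun u h => by simp at h⟩

/-- The data of a labelling scheme with labels of size `s` for one specific graph with vertex
set `V`: a deterministic decoder and a randomized encoder, i.e. a probability distribution over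
labelling functions. (The scheme is designed for this graph; the distribution over the labelling
functions is arbitrary, so labels of different vertices may be correlated.) -/
structure LabellingScheme (V : Type) (s : ℕ) where
  /-- the decoder -/
  decoder : Label s → Label s → Bool
  /-- the distribution of the labelling function -/
  encoder : PMF (V → Label s)

/-- A deterministic adaptive strategy of the adversary, as a decision tree: either declare a pair
of candidates, or query the label of a vertex and continue depending on the answer. -/
inductive Strategy (V L : Type) : Type
  | declare (x y : V) : Strategy V L
  | query (x : V) (next : L → Strategy V L) : Strategy V L

namespace Strategy

variable {V L : Type}

/-- The list `x₁, …, x_k` of the queried vertices when the labelling function is `ℓ`. -/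
def queries : Strategy V L → (V → L) → List V
  | declare _ _, _ => []
  | query x next, ℓ => x :: queries (next (ℓ x)) ℓ

/-- The declared candidates `(x_{k+1}, x_{k+2})` when the labelling function is `ℓ`. -/
def candidates : Strategy V L → (V → L) → V × V
  | declare x y, _ => (x, y)
  | query x next, ℓ => candidates (next (ℓ x)) ℓ

end Strategy

namespace LabellingScheme

variable {V : Type} {s : ℕ}

/-- The pair `u, v` of vertices is decoded correctly under the labelling function `ℓ`. -/
def Correct (S : LabellingScheme V s) (G : SimpleGraph V) (ℓ : V → Label s) (u v : V) : Prop :=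
  S.decoder (ℓ u) (ℓ v) = true ↔ G.Adj u v

/-- `S` is an adjacency sketch for `G` with error `δ`: every pair of vertices (equal vertices
included) is decoded correctly with probability at least `1 - δ`. -/
def IsAdjacencySketch (S : LabellingScheme V s) (G : SimpleGraph V) (δ : ℝ) : Prop :=
  ∀ u v : V, ENNReal.ofReal (1 - δ) ≤ S.encoder.toOuterMeasure {ℓ | S.Correct G ℓ u v}

/-- `S` only errs on non-edges: under every labelling function that the encoder can output, every
edge is decoded correctly. -/
def ErrsOnlyOnNonEdges (S : LabellingScheme V s) (G : SimpleGraph V) : Prop :=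
  ∀ ℓ ∈ S.encoder.support, ∀ u v : V, G.Adj u v → S.decoder (ℓ u) (ℓ v) = true

/-- The adversary playing `σ` wins against the labelling function `ℓ`: it made at most `n - 2`
queries, the two candidates are distinct and were not queried, and they are decoded wrongly. -/
def Wins [Fintype V] (S : LabellingScheme V s) (G : SimpleGraph V) (σ : Strategy V (Label s))
    (ℓ : V → Label s) : Prop :=
  (σ.queries ℓ).length + 2 ≤ Fintype.card V ∧
  (σ.candidates ℓ).1 ≠ (σ.candidates ℓ).2 ∧
  (σ.candidates ℓ).1 ∉ σ.queries ℓ ∧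
  (σ.candidates ℓ).2 ∉ σ.queries ℓ ∧
  ¬ S.Correct G ℓ (σ.candidates ℓ).1 (σ.candidates ℓ).2

/-- The probability that a randomized adversary (a distribution `A` over deterministic adaptive
strategies, drawn independently of the labels) wins the game. -/
noncomputable def forgeryProbability [Fintype V] (S : LabellingScheme V s) (G : SimpleGraph V)
    (A : PMF (Strategy V (Label s))) : ℝ≥0∞ :=
  ∑' σ, A σ * S.encoder.toOuterMeasure {ℓ | S.Wins G σ ℓ}

/-- `S` is adversarially resilient with probability of forgery `ε`: every adversary wins the game
with probability at most `ε`. -/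
def IsResilient [Fintype V] (S : LabellingScheme V s) (G : SimpleGraph V) (ε : ℝ) : Prop :=
  ∀ A : PMF (Strategy V (Label s)), S.forgeryProbability G A ≤ ENNReal.ofReal ε

/-- A resilient labelling scheme for `G`: an adjacency sketch with error `δ` that only errs on
non-edges and is adversarially resilient with probability of forgery `ε`. -/
structure IsResilientScheme [Fintype V] (S : LabellingScheme V s) (G : SimpleGraph V)
    (δ ε : ℝ) : Prop where
  sketch : S.IsAdjacencySketch G δ
  one_sided : S.ErrsOnlyOnNonEdges G
  resilient : S.IsResilient G ε

end LabellingScheme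

/-! Lower bound. Take exponentially many centres `c z` in the cube at mutual distance at least 3,
and let round `j` reveal the `j`-th neighbours of all centres. The conditional entropy of the label
of `c z`, averaged over `z`, starts at most `s` and never becomes negative, so one of the `d` rounds
lowers it by at most `s / d`. The adversary stops just before that round. A centre and its own next
neighbour surely decode as adjacent; since that round teaches little, a fresh sample of the centre's
label given the revealed labels is rarely rejected by the neighbour's label either
(`sum_hitProb_le_condEntropy_sub`). What a centre rejects is summarised by `k` samples of its label
(`exists_samples`), with `k` of order `s` to survive a union bound over `2 ^ s` labels. There are at
most `2 ^ (s * k)` summaries, far fewer than centres if `s ^ 2` is small against `d`, so distinct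
`x`, `z` share one, and then a fresh label of `c x` is rarely rejected by the neighbour of `c z`.
The small entropy loss carries this over to the true labels (`sum_hit_le`), and the adversary
declares this non-adjacent pair. Entropy losses are small only on average over the centres, so plain
pigeonhole is replaced by a coupling with uniform marginals (`exists_coupling`);
`one_le_forgery_bound` assembles the pieces.

Upper bound. If every vertex uses its own private coins, queries reveal nothing about the two
declared vertices, so a one-sided private-coin protocol suffices
(`privateCoinScheme_isResilientScheme`). Hashing the coordinates into constantly many buckets and
adding modulo 2 tests distance 1 with one-sided error, and `m * m > d` fixed bucketings serve all
pairs at once (`exists_bucketings`). Arrange them in an `m × m` grid: a label holds the bucket sums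
along a random row and a random column. The row of one vertex meets the column of the other in a
uniformly random bucketing, at a cost of `O(m)` bits. -/

/-! ### Conditional distributions, Gibbs' inequality and conditional entropy. -/

section CondProb

variable {Ω τ A : Type*} [Fintype Ω] [DecidableEq τ] [DecidableEq A]

/-- The conditional probability of `X = a` given `T = t`, for the weights `p`. -/
noncomputable def condProb (p : Ω → ℝ) (T : Ω → τ) (X : Ω → A) (t : τ) (a : A) : ℝ :=
  (∑ ω with T ω = t ∧ X ω = a, p ω) / ∑ ω with T ω = t, p ω

lemma condProb_nonneg {p : Ω → ℝ} (hp : ∀ ω, 0 ≤ p ω) (T : Ω → τ) (X : Ω → A) (t : τ) (a : A) :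
    0 ≤ condProb p T X t a :=
  div_nonneg (Finset.sum_nonneg fun _ _ => hp _) (Finset.sum_nonneg fun _ _ => hp _)

lemma condProb_le_one {p : Ω → ℝ} (hp : ∀ ω, 0 ≤ p ω) (T : Ω → τ) (X : Ω → A) (t : τ) (a : A) :
    condProb p T X t a ≤ 1 := by
  refine div_le_one_of_le₀ (Finset.sum_le_sum_of_subset_of_nonneg ?_ fun _ _ _ => hp _)
    (Finset.sum_nonneg fun _ _ => hp _)
  intro ω
  simp +contextual

lemma condProb_pos {p : Ω → ℝ} (hp : ∀ ω, 0 ≤ p ω) (T : Ω → τ) (X : Ω → A) {ω : Ω}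
    (hω : 0 < p ω) : 0 < condProb p T X (T ω) (X ω) := by
  refine div_pos (Finset.sum_pos' (fun _ _ => hp _) ⟨ω, ?_, hω⟩)
    (Finset.sum_pos' (fun _ _ => hp _) ⟨ω, ?_, hω⟩) <;> simp

variable [Fintype A]

lemma sum_fiber_eq (p : Ω → ℝ) (T : Ω → τ) (X : Ω → A) (t : τ) (f : A → ℝ) :
    ∑ ω with T ω = t, p ω * f (X ω) = ∑ a, (∑ ω with T ω = t ∧ X ω = a, p ω) * f a := by
  rw [← Finset.sum_fiberwise (Finset.univ.filter fun ω => T ω = t) X]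
  refine Finset.sum_congr rfl fun a _ => ?_
  rw [Finset.filter_filter, Finset.sum_mul]
  refine Finset.sum_congr rfl fun ω hω => ?_
  rw [(Finset.mem_filter.1 hω).2.2]

lemma sum_condProb (p : Ω → ℝ) (T : Ω → τ) (X : Ω → A) {t : τ}
    (ht : ∑ ω with T ω = t, p ω ≠ 0) : ∑ a, condProb p T X t a = 1 := by
  have h := sum_fiber_eq p T X t fun _ => 1
  simp only [mul_one] at h
  simp only [condProb]
  rw [← Finset.sum_div, ← h, div_self ht]

/-- The law of total expectation on one fiber. -/
lemma sum_fiber_eq_condProb {p : Ω → ℝ} (hp : ∀ ω, 0 ≤ p ω) (T : Ω → τ) (X : Ω → A) (t : τ)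
    (f : A → ℝ) :
    ∑ ω with T ω = t, p ω * f (X ω) =
      (∑ ω with T ω = t, p ω) * ∑ a, condProb p T X t a * f a := by
  rw [sum_fiber_eq, Finset.mul_sum]
  refine Finset.sum_congr rfl fun a _ => ?_
  rw [← mul_assoc]
  congr 1
  by_cases h : ∑ ω with T ω = t, p ω = 0
  · rw [h, zero_mul]
    refine le_antisymm ?_ (Finset.sum_nonneg fun _ _ => hp _)
    rw [← h]
    refine Finset.sum_le_sum_of_subset_of_nonneg ?_ fun _ _ _ => hp _
    intro ω
    simp +contextual
  · rw [condProb, mul_div_cancel₀ _ h]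

variable [Fintype τ]

/-- The law of total expectation. -/
lemma sum_eq_sum_condProb {p : Ω → ℝ} (hp : ∀ ω, 0 ≤ p ω) (T : Ω → τ) (X : Ω → A)
    (f : τ → A → ℝ) :
    ∑ ω, p ω * f (T ω) (X ω) = ∑ ω, p ω * ∑ a, condProb p T X (T ω) a * f (T ω) a := by
  rw [← Finset.sum_fiberwise Finset.univ T, ← Finset.sum_fiberwise Finset.univ T]
  refine Finset.sum_congr rfl fun t _ => ?_
  have h1 : ∑ ω with T ω = t, p ω * f (T ω) (X ω) = ∑ ω with T ω = t, p ω * f t (X ω) :=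
    Finset.sum_congr rfl fun ω hω => by rw [(Finset.mem_filter.1 hω).2]
  rw [h1, sum_fiber_eq_condProb hp, Finset.sum_mul]
  exact Finset.sum_congr rfl fun ω hω => by rw [(Finset.mem_filter.1 hω).2]

/-- A form of Gibbs' inequality for conditional distributions. -/
lemma sum_log_sub_log_condProb_le {p : Ω → ℝ} (hp : ∀ ω, 0 ≤ p ω) (T : Ω → τ) (X : Ω → A)
    (w : τ → ℝ) (hw : ∀ t, 0 ≤ w t) (F : τ → A → ℝ) (hF : ∀ t a, 0 ≤ F t a)
    (hF' : ∀ ω, 0 < p ω → 0 < F (T ω) (X ω)) :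
    ∑ ω, p ω * (w (T ω) * (Real.log (F (T ω) (X ω)) - Real.log (condProb p T X (T ω) (X ω)))) ≤
      ∑ ω, p ω * (w (T ω) * (∑ a, F (T ω) a - 1)) := by
  have h1 : ∑ ω, p ω *
      (w (T ω) * (Real.log (F (T ω) (X ω)) - Real.log (condProb p T X (T ω) (X ω)))) ≤
      ∑ ω, p ω * (w (T ω) * (F (T ω) (X ω) / condProb p T X (T ω) (X ω) - 1)) := by
    refine Finset.sum_le_sum fun ω _ => ?_
    rcases (hp ω).eq_or_lt with h | h
    · simp [← h]
    · have hc := condProb_pos hp T X h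
      rw [← Real.log_div (hF' ω h).ne' hc.ne']
      exact mul_le_mul_of_nonneg_left (mul_le_mul_of_nonneg_left
        (Real.log_le_sub_one_of_pos (div_pos (hF' ω h) hc)) (hw _)) h.le
  refine h1.trans ?_
  -- After `log x ≤ x - 1`, averaging over the conditional law cancels the denominators. Mass of `F`
  -- on values of conditional probability 0 is lost, hence only an inequality.
  rw [sum_eq_sum_condProb hp T X fun t a => w t * (F t a / condProb p T X t a - 1)]
  refine Finset.sum_le_sum fun ω _ => ?_
  rcases (hp ω).eq_or_lt with h | h
  · simp [← h]
  refine mul_le_mul_of_nonneg_left ?_ h.le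
  have hP : 0 < ∑ ω' with T ω' = T ω, p ω' :=
    Finset.sum_pos' (fun _ _ => hp _) ⟨ω, Finset.mem_filter.2 ⟨Finset.mem_univ _, rfl⟩, h⟩
  have h1 : ∑ a, F (T ω) a - 1 = ∑ a, (F (T ω) a - condProb p T X (T ω) a) := by
    rw [Finset.sum_sub_distrib, sum_condProb p T X hP.ne']
  rw [h1, Finset.mul_sum]
  refine Finset.sum_le_sum fun a _ => ?_
  rw [mul_left_comm]
  refine mul_le_mul_of_nonneg_left ?_ (hw _)
  rcases (condProb_nonneg hp T X (T ω) a).eq_or_lt with h0 | h0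
  · rw [← h0]
    simpa using hF _ _
  · rw [mul_sub, mul_div_cancel₀ _ h0.ne', mul_one]

/-- The conditional entropy of `X` given `T`. -/
noncomputable def condEntropy (p : Ω → ℝ) (T : Ω → τ) (X : Ω → A) : ℝ :=
  -∑ ω, p ω * Real.log (condProb p T X (T ω) (X ω))

omit [Fintype A] [Fintype τ] in
lemma condEntropy_nonneg {p : Ω → ℝ} (hp : ∀ ω, 0 ≤ p ω) (T : Ω → τ) (X : Ω → A) :
    0 ≤ condEntropy p T X := by
  rw [condEntropy, ← Finset.sum_neg_distrib]
  refine Finset.sum_nonneg fun ω _ => ?_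
  have := mul_nonneg (hp ω) (neg_nonneg.2 (Real.log_nonpos (condProb_nonneg hp T X (T ω) (X ω))
    (condProb_le_one hp T X (T ω) (X ω))))
  linarith

/-- Gibbs' inequality against the uniform distribution on `A`. -/
lemma condEntropy_le {p : Ω → ℝ} (hp : ∀ ω, 0 ≤ p ω) (hp1 : ∑ ω, p ω = 1) (T : Ω → τ)
    (X : Ω → A) : condEntropy p T X ≤ Real.log (Fintype.card A) := by
  have : Nonempty Ω := by
    by_contra h
    rw [not_nonempty_iff] at h
    simp at hp1
  have : Nonempty A := this.map X
  have hA : (0 : ℝ) < Fintype.card A := by exact_mod_cast Fintype.card_pos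
  have h := sum_log_sub_log_condProb_le hp T X (fun _ => 1) (fun _ => zero_le_one)
    (fun _ _ => (Fintype.card A : ℝ)⁻¹) (fun _ _ => (inv_pos.2 hA).le) (fun _ _ => inv_pos.2 hA)
  simp only [one_mul, Finset.sum_const, Finset.card_univ, nsmul_eq_mul, mul_inv_cancel₀ hA.ne',
    sub_self, mul_zero, Real.log_inv, mul_sub, Finset.sum_sub_distrib, mul_neg,
    Finset.sum_neg_distrib, ← Finset.sum_mul, hp1] at h
  rw [condEntropy]
  linarith

end CondProb

/-! ### Representing distributions by few samples, and pairing those with equal samples. -/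

section Sampling

variable {A B : Type*} [Fintype A]

/-- The probability that a `μ`-random element is in relation `r` to `b`. -/
noncomputable def hitProb (r : A → B → Prop) [∀ a b, Decidable (r a b)] (μ : A → ℝ) (b : B) : ℝ :=
  ∑ a, if r a b then μ a else 0

variable (r : A → B → Prop) [∀ a b, Decidable (r a b)]

lemma hitProb_le_one {μ : A → ℝ} (hμ : ∀ a, 0 ≤ μ a) (hμ1 : ∑ a, μ a = 1) (b : B) :
    hitProb r μ b ≤ 1 := by
  rw [← hμ1]
  exact Finset.sum_le_sum fun a _ => by split_ifs <;> simp [hμ]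

lemma sum_prod_avoid {μ : A → ℝ} (hμ1 : ∑ a, μ a = 1) (k : ℕ) (b : B) :
    ∑ f : Fin k → A, (∏ i, μ (f i)) * (if ∀ i, ¬ r (f i) b then 1 else 0) =
      (1 - hitProb r μ b) ^ k := by
  have h1 : 1 - hitProb r μ b = ∑ a, (if r a b then 0 else μ a) := by
    rw [← hμ1, hitProb, ← Finset.sum_sub_distrib]
    exact Finset.sum_congr rfl fun a _ => by split_ifs <;> simp
  rw [h1, Fintype.sum_pow]
  refine Finset.sum_congr rfl fun f _ => ?_
  by_cases h : ∀ i, ¬ r (f i) b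
  · rw [if_pos h, mul_one]
    exact Finset.prod_congr rfl fun i _ => by rw [if_neg (h i)]
  · rw [if_neg h, mul_zero]
    push Not at h
    obtain ⟨i, hi⟩ := h
    exact (Finset.prod_eq_zero (Finset.mem_univ i) (by rw [if_pos hi])).symm

/-- Few samples from `μ` represent it: they hit every `b` that is hit with probability at least
`θ`, and rarely hit a `ν`-random `b` unless `μ` does. -/
lemma exists_samples [Fintype B] {μ : A → ℝ} (hμ : ∀ a, 0 ≤ μ a) (hμ1 : ∑ a, μ a = 1) {ν : B → ℝ}
    (hν : ∀ b, 0 ≤ ν b) {θ : ℝ} (hθ : θ ≤ 1) (k : ℕ) :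
    ∃ f : Fin k → A,
      ∑ b, ν b * (if ∃ i, r (f i) b then 1 else 0) +
        ∑ b, (if θ ≤ hitProb r μ b ∧ ∀ i, ¬ r (f i) b then 1 else 0) ≤
      k * ∑ b, ν b * hitProb r μ b + Fintype.card B * (1 - θ) ^ k := by
  classical
  have hprod : ∑ f : Fin k → A, ∏ i, μ (f i) = 1 := by
    rw [← Fintype.sum_pow, hμ1, one_pow]
  by_contra! hcon
  -- First-moment method: the bound holds on average over `k` independent samples from `μ`.
  have key : ∑ f : Fin k → A, (∏ i, μ (f i)) *
      (∑ b, ν b * (if ∃ i, r (f i) b then 1 else 0) +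
        ∑ b, (if θ ≤ hitProb r μ b ∧ ∀ i, ¬ r (f i) b then 1 else 0)) ≤
      k * ∑ b, ν b * hitProb r μ b + Fintype.card B * (1 - θ) ^ k := by
    simp only [mul_add, Finset.sum_add_distrib, Finset.mul_sum]
    refine add_le_add ?_ ?_
    · rw [Finset.sum_comm]
      refine Finset.sum_le_sum fun b _ => ?_
      have h1 : ∑ f : Fin k → A, (∏ i, μ (f i)) * (if ∃ i, r (f i) b then 1 else 0) =
          1 - (1 - hitProb r μ b) ^ k := by
        rw [← sum_prod_avoid r hμ1 k b, eq_sub_iff_add_eq, ← Finset.sum_add_distrib]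
        refine Eq.trans ?_ hprod
        refine Finset.sum_congr rfl fun f _ => ?_
        by_cases h : ∃ i, r (f i) b
        · have h' : ¬ ∀ i, ¬ r (f i) b := by push Not; exact h
          rw [if_pos h, if_neg h']; ring
        · have h' : ∀ i, ¬ r (f i) b := by push Not at h; exact h
          rw [if_neg h, if_pos h']; ring
      -- Bernoulli's inequality, a union bound over the samples: some sample hits `b` with
      -- probability at most `k * hitProb r μ b`.
      have h2 := one_add_mul_le_pow (a := -hitProb r μ b)
        (by linarith [hitProb_le_one r hμ hμ1 b]) k
      have h3 : ∑ f : Fin k → A, (∏ i, μ (f i)) * (ν b * if ∃ i, r (f i) b then 1 else 0) =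
          ν b * (1 - (1 - hitProb r μ b) ^ k) := by
        rw [← h1, Finset.mul_sum]
        exact Finset.sum_congr rfl fun f _ => by ring
      rw [h3, mul_left_comm]
      refine mul_le_mul_of_nonneg_left ?_ (hν b)
      rw [sub_eq_add_neg 1 (hitProb r μ b)]
      linarith
    · rw [Finset.sum_comm, ← nsmul_eq_mul, ← Finset.card_univ]
      refine Finset.sum_le_card_nsmul _ _ _ fun b _ => ?_
      by_cases hb : θ ≤ hitProb r μ b
      · simp only [hb, true_and]
        rw [sum_prod_avoid r hμ1 k b]
        exact pow_le_pow_left₀ (by linarith [hitProb_le_one r hμ hμ1 b]) (by linarith) k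
      · simp only [hb, false_and, if_false, mul_zero, Finset.sum_const_zero]
        exact pow_nonneg (by linarith) k
  refine absurd key (not_le.2 ?_)
  obtain ⟨f, -, hf⟩ : ∃ f ∈ (Finset.univ : Finset (Fin k → A)), (0 : ℝ) < ∏ i, μ (f i) := by
    refine Finset.exists_lt_of_sum_lt (f := fun _ => (0 : ℝ)) ?_
    simp [hprod]
  generalize k * ∑ b, ν b * hitProb r μ b + Fintype.card B * (1 - θ) ^ k = K at hcon ⊢
  have hK : K = ∑ f : Fin k → A, (∏ i, μ (f i)) * K := by rw [← Finset.sum_mul, hprod, one_mul]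
  rw [hK]
  refine Finset.sum_lt_sum (fun f _ => mul_le_mul_of_nonneg_left (hcon f).le
    (Finset.prod_nonneg fun _ _ => hμ _)) ⟨f, Finset.mem_univ f, ?_⟩
  exact mul_lt_mul_of_pos_left (hcon f) hf

variable {Z : Type*} [Fintype Z] [Nonempty Z]

/-- A doubly stochastic coupling that is constant on the fibers of `g`. -/
lemma exists_fiber_coupling {C : Type*} [Fintype C] [DecidableEq C] (g : Z → C) :
    ∃ w : Z → Z → ℝ, (∀ x z, 0 ≤ w x z) ∧ (∀ x, ∑ z, w x z = (Fintype.card Z : ℝ)⁻¹) ∧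
      (∀ z, ∑ x, w x z = (Fintype.card Z : ℝ)⁻¹) ∧
      ∑ z, w z z ≤ Fintype.card C * (Fintype.card Z : ℝ)⁻¹ ∧ ∀ x z, w x z ≠ 0 → g x = g z := by
  set N : C → ℝ := fun c => ((Finset.univ.filter fun z => g z = c).card : ℝ) with hN
  have hpos : ∀ z, 0 < N (g z) := fun z => by
    simp only [hN, Nat.cast_pos, Finset.card_pos]
    exact ⟨z, by simp⟩
  -- The coupling draws `x` uniformly and then `z` uniformly from the fiber of `x`. Each nonempty
  -- fiber puts mass `1 / |Z|` on the diagonal.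
  have hrow : ∀ x, ∑ z, (if g x = g z then (Fintype.card Z : ℝ)⁻¹ * (N (g z))⁻¹ else 0) =
      (Fintype.card Z : ℝ)⁻¹ := fun x => by
    rw [← Finset.sum_filter]
    have : ∀ z ∈ Finset.univ.filter (fun z => g x = g z),
        (Fintype.card Z : ℝ)⁻¹ * (N (g z))⁻¹ = (Fintype.card Z : ℝ)⁻¹ * (N (g x))⁻¹ :=
      fun z hz => by rw [(Finset.mem_filter.1 hz).2]
    rw [Finset.sum_congr rfl this, Finset.sum_const, nsmul_eq_mul]
    have h2 : ((Finset.univ.filter fun z => g x = g z).card : ℝ) = N (g x) := by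
      simp only [hN, eq_comm]
    rw [h2, mul_left_comm, mul_inv_cancel₀ (hpos x).ne', mul_one]
  refine ⟨fun x z => if g x = g z then (Fintype.card Z : ℝ)⁻¹ * (N (g z))⁻¹ else 0, ?_, hrow, ?_,
    ?_, ?_⟩
  · intro x z
    dsimp only
    split_ifs <;> positivity
  · intro z
    refine Eq.trans ?_ (hrow z)
    refine Finset.sum_congr rfl fun x _ => ?_
    by_cases h : g x = g z
    · simp only [h, if_true]
    · simp only [h, Ne.symm h, if_false]
  · simp only [if_true]
    rw [← Finset.mul_sum, mul_comm]
    refine mul_le_mul_of_nonneg_right ?_ (by positivity)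
    rw [← Finset.sum_fiberwise Finset.univ g]
    have : ∀ c ∈ (Finset.univ : Finset C), ∑ z with g z = c, (N (g z))⁻¹ ≤ (1 : ℝ) := by
      intro c _
      have h1 : ∀ z ∈ Finset.univ.filter (fun z => g z = c), (N (g z))⁻¹ = (N c)⁻¹ :=
        fun z hz => by rw [(Finset.mem_filter.1 hz).2]
      rw [Finset.sum_congr rfl h1, Finset.sum_const, nsmul_eq_mul]
      exact mul_inv_le_one
    simpa using Finset.sum_le_sum this
  · intro x z h
    by_contra h'
    exact h (if_neg h')

/-- The members of a family of distributions can be paired such that `μ z` and `μ x` hit a `ν z`-random element about equally rarely; only few are paired with themselves if the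
family is large compared to the number of sample tuples. -/
lemma exists_coupling [Fintype B] {μ : Z → A → ℝ} (hμ : ∀ z a, 0 ≤ μ z a) (hμ1 : ∀ z, ∑ a, μ z a = 1)
    {ν : Z → B → ℝ} (hν : ∀ z b, 0 ≤ ν z b) (hν1 : ∀ z, ∑ b, ν z b = 1) {θ : ℝ} (hθ0 : 0 ≤ θ)
    (hθ : θ ≤ 1) (k : ℕ) :
    ∃ w : Z → Z → ℝ, (∀ x z, 0 ≤ w x z) ∧ (∀ x, ∑ z, w x z = (Fintype.card Z : ℝ)⁻¹) ∧
      (∀ z, ∑ x, w x z = (Fintype.card Z : ℝ)⁻¹) ∧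
      ∑ z, w z z ≤ (Fintype.card A : ℝ) ^ k * (Fintype.card Z : ℝ)⁻¹ ∧
      ∑ x, ∑ z, w x z * ∑ b, ν z b * hitProb r (μ x) b ≤
        θ + 2 * ((Fintype.card Z : ℝ)⁻¹ * ∑ z, (k * ∑ b, ν z b * hitProb r (μ z) b +
          Fintype.card B * (1 - θ) ^ k)) := by
  classical
  choose f hf using fun z => exists_samples r (hμ z) (hμ1 z) (hν z) hθ k
  obtain ⟨w, hw0, hwr, hwc, hwd, hwg⟩ := exists_fiber_coupling f
  refine ⟨w, hw0, hwr, hwc, by simpa using hwd, ?_⟩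
  set cost : Z → ℝ := fun z => (k * ∑ b, ν z b * hitProb r (μ z) b +
          Fintype.card B * (1 - θ) ^ k) with hcost
  set kill : Z → ℝ := fun z => ∑ b, ν z b * (if ∃ i, r (f z i) b then 1 else 0) with hkill
  set fail : Z → ℝ := fun z =>
    ∑ b, (if θ ≤ hitProb r (μ z) b ∧ ∀ i, ¬ r (f z i) b then 1 else 0) with hfail
  have hkill0 : ∀ z, 0 ≤ kill z := fun z => Finset.sum_nonneg fun b _ => by
    have := hν z b
    split_ifs <;> simp [this]
  have hfail0 : ∀ z, 0 ≤ fail z := fun z => Finset.sum_nonneg fun b _ => by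
    split_ifs <;> simp
  have hkf : ∀ z, kill z + fail z ≤ cost z := hf
  have h1 : ∀ x z, w x z * ∑ b, ν z b * hitProb r (μ x) b ≤
      w x z * (θ + cost z + cost x) := by
    intro x z
    by_cases hxz : w x z = 0
    · simp [hxz]
    have hg := hwg x z hxz
    refine mul_le_mul_of_nonneg_left ?_ (hw0 x z)
    -- As `x` and `z` share their samples, a `b` avoided by the samples of `z` is avoided by those
    -- of `x`. It is then either hit by `μ x` with probability below `θ`, or counted in `fail x`,
    -- which is then at least 1.
    have h2 : ∀ b, hitProb r (μ x) b ≤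
        θ + (if ∃ i, r (f z i) b then 1 else 0) + fail x := by
      intro b
      have hle := hitProb_le_one r (hμ x) (hμ1 x) b
      by_cases hb : ∃ i, r (f z i) b
      · rw [if_pos hb]; linarith [hfail0 x]
      · rw [if_neg hb]
        by_cases hb' : θ ≤ hitProb r (μ x) b
        · have : (1 : ℝ) ≤ fail x := by
            have h3 := Finset.single_le_sum (f := fun b => if θ ≤ hitProb r (μ x) b ∧
              ∀ i, ¬ r (f x i) b then (1 : ℝ) else 0)
              (fun b _ => by split_ifs <;> simp) (Finset.mem_univ b)
            have h4 : θ ≤ hitProb r (μ x) b ∧ ∀ i, ¬ r (f x i) b := by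
              refine ⟨hb', ?_⟩
              rw [hg]; push Not at hb; exact hb
            rwa [if_pos h4] at h3
          linarith
        · linarith [hfail0 x]
    calc ∑ b, ν z b * hitProb r (μ x) b
        ≤ ∑ b, ν z b * (θ + (if ∃ i, r (f z i) b then 1 else 0) + fail x) :=
          Finset.sum_le_sum fun b _ => mul_le_mul_of_nonneg_left (h2 b) (hν z b)
      _ = θ + kill z + fail x := by
          simp only [mul_add, Finset.sum_add_distrib, ← Finset.sum_mul, hν1, one_mul, hkill]
      _ ≤ θ + cost z + cost x := by linarith [hkf x, hkf z, hkill0 x, hfail0 z]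
  have hZ : (0 : ℝ) < Fintype.card Z := by exact_mod_cast Fintype.card_pos
  calc ∑ x, ∑ z, w x z * ∑ b, ν z b * hitProb r (μ x) b
      ≤ ∑ x, ∑ z, w x z * (θ + cost z + cost x) :=
        Finset.sum_le_sum fun x _ => Finset.sum_le_sum fun z _ => h1 x z
    _ = ∑ x, ∑ z, w x z * θ + ∑ z, ∑ x, w x z * cost z + ∑ x, ∑ z, w x z * cost x := by
        rw [Finset.sum_comm (f := fun z x => w x z * cost z)]
        simp only [mul_add, Finset.sum_add_distrib]
    _ = _ := by
        simp only [← Finset.sum_mul, hwr, hwc]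
        rw [Finset.sum_const, Finset.card_univ, nsmul_eq_mul, mul_inv_cancel₀ hZ.ne',
          ← Finset.mul_sum]
        ring

end Sampling

/-! ### What a small entropy loss says about hitting probabilities. -/

section Refinement

variable {Ω τ σ A B : Type*} [Fintype Ω] [Fintype τ] [DecidableEq τ] [DecidableEq σ] [Fintype σ]
  [Fintype A] [DecidableEq A] (r : A → B → Prop) [∀ a b, Decidable (r a b)]

omit [Fintype τ] [DecidableEq τ] [Fintype σ] in
lemma sum_condProb_self {p : Ω → ℝ} (hp : ∀ ω, 0 ≤ p ω) (R : Ω → σ) (X : Ω → A) {ω : Ω}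
    (hω : 0 < p ω) : ∑ a, condProb p R X (R ω) a = 1 := by
  have hP : 0 < ∑ ω' with R ω' = R ω, p ω' :=
    Finset.sum_pos' (fun _ _ => hp _) ⟨ω, Finset.mem_filter.2 ⟨Finset.mem_univ _, rfl⟩, hω⟩
  exact sum_condProb p R X hP.ne'

omit [Fintype σ] in
/-- If `X` surely avoids `Y`, then an independent resampling of `X` is likely to avoid `Y` unless
learning `Y` decreases the entropy of `X`. -/
lemma sum_hitProb_le_condEntropy_sub {p : Ω → ℝ} (hp : ∀ ω, 0 ≤ p ω) (T : Ω → τ) (φ : τ → σ)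
    (ψ : τ → B) (X : Ω → A) (hX : ∀ ω, 0 < p ω → ¬ r (X ω) (ψ (T ω))) :
    ∑ ω, p ω * hitProb r (condProb p (φ ∘ T) X (φ (T ω))) (ψ (T ω)) ≤
      condEntropy p (φ ∘ T) X - condEntropy p T X := by
  -- Comparison with the coarse law restricted to the values that avoid `ψ t`: its mass falls short
  -- of 1 by exactly the hitting probability.
  have h := sum_log_sub_log_condProb_le hp T X (fun _ => 1) (fun _ => zero_le_one)
    (fun t a => if r a (ψ t) then 0 else condProb p (φ ∘ T) X (φ t) a)
    (fun t a => by
      split_ifs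
      · exact le_rfl
      · exact condProb_nonneg hp _ _ _ _)
    (fun ω hω => by
      rw [if_neg (hX ω hω)]
      exact condProb_pos hp (φ ∘ T) X hω)
  have h1 : ∀ ω, p ω * (1 * (∑ a, (if r a (ψ (T ω)) then 0 else
      condProb p (φ ∘ T) X (φ (T ω)) a) - 1)) =
      -(p ω * hitProb r (condProb p (φ ∘ T) X (φ (T ω))) (ψ (T ω))) := by
    intro ω
    rcases (hp ω).eq_or_lt with h0 | h0
    · simp [← h0]
    have h2 := sum_condProb_self hp (φ ∘ T) X h0
    simp only [Function.comp_apply] at h2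
    rw [one_mul, ← mul_neg, hitProb, ← Finset.sum_neg_distrib]
    congr 1
    refine (congrArg _ h2.symm).trans ?_
    rw [← Finset.sum_sub_distrib]
    refine Finset.sum_congr rfl fun a _ => ?_
    split_ifs <;> simp
  have h3 : ∀ ω, p ω * (1 * (Real.log (if r (X ω) (ψ (T ω)) then 0 else
      condProb p (φ ∘ T) X (φ (T ω)) (X ω)) - Real.log (condProb p T X (T ω) (X ω)))) =
      p ω * Real.log (condProb p (φ ∘ T) X (φ (T ω)) (X ω)) -
        p ω * Real.log (condProb p T X (T ω) (X ω)) := by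
    intro ω
    rcases (hp ω).eq_or_lt with h0 | h0
    · simp [← h0]
    rw [if_neg (hX ω h0), one_mul, mul_sub]
  rw [Finset.sum_congr rfl fun ω _ => h1 ω, Finset.sum_congr rfl fun ω _ => h3 ω,
    Finset.sum_neg_distrib, Finset.sum_sub_distrib] at h
  simp only [condEntropy, Function.comp_apply]
  linarith

omit [Fintype σ] in
/-- If an independent resampling of `X` is unlikely to hit `Y`, then so is `X` itself unless
learning `Y` decreases the entropy of `X`. -/
lemma sum_hit_le {p : Ω → ℝ} (hp : ∀ ω, 0 ≤ p ω) (T : Ω → τ) (φ : τ → σ)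
    (ψ : τ → B) (X : Ω → A) (w : σ → ℝ) (hw : ∀ t, 0 ≤ w t) :
    ∑ ω, p ω * (w (φ (T ω)) * (if r (X ω) (ψ (T ω)) then 1 else 0)) ≤
      ∑ ω, p ω * (w (φ (T ω)) * (Real.log (condProb p T X (T ω) (X ω)) -
        Real.log (condProb p (φ ∘ T) X (φ (T ω)) (X ω)))) +
      2 * ∑ ω, p ω * (w (φ (T ω)) *
        hitProb r (condProb p (φ ∘ T) X (φ (T ω))) (ψ (T ω))) := by
  -- Comparison with the coarse law tilted by a factor `e` on the values that hit `ψ t`: its mass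
  -- exceeds 1 by `e - 1 < 2` times the hitting probability.
  have h := sum_log_sub_log_condProb_le hp T X (fun t => w (φ t)) (fun _ => hw _)
    (fun t a => condProb p (φ ∘ T) X (φ t) a * Real.exp (if r a (ψ t) then 1 else 0))
    (fun t a => mul_nonneg (condProb_nonneg hp _ _ _ _) (Real.exp_pos _).le)
    (fun ω hω => mul_pos (condProb_pos hp (φ ∘ T) X hω) (Real.exp_pos _))
  have h1 : ∀ ω, p ω * (w (φ (T ω)) * (∑ a, condProb p (φ ∘ T) X (φ (T ω)) a *
      Real.exp (if r a (ψ (T ω)) then 1 else 0) - 1)) ≤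
      2 * (p ω * (w (φ (T ω)) *
        hitProb r (condProb p (φ ∘ T) X (φ (T ω))) (ψ (T ω)))) := by
    intro ω
    rcases (hp ω).eq_or_lt with h0 | h0
    · simp [← h0]
    have h2 := sum_condProb_self hp (φ ∘ T) X h0
    simp only [Function.comp_apply] at h2
    rw [mul_left_comm 2, mul_left_comm 2]
    refine mul_le_mul_of_nonneg_left (mul_le_mul_of_nonneg_left ?_ (hw _)) h0.le
    refine (congrArg _ h2.symm).le.trans ?_
    rw [← Finset.sum_sub_distrib, hitProb, Finset.mul_sum]
    refine Finset.sum_le_sum fun a _ => ?_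
    have h3 := condProb_nonneg hp (φ ∘ T) X (φ (T ω)) a
    have h4 := Real.exp_one_lt_d9
    split_ifs
    · nlinarith
    · simp
  have h3 : ∀ ω, p ω * (w (φ (T ω)) * (Real.log (condProb p (φ ∘ T) X (φ (T ω)) (X ω) *
      Real.exp (if r (X ω) (ψ (T ω)) then 1 else 0)) -
        Real.log (condProb p T X (T ω) (X ω)))) =
      p ω * (w (φ (T ω)) * (if r (X ω) (ψ (T ω)) then 1 else 0)) -
      p ω * (w (φ (T ω)) * (Real.log (condProb p T X (T ω) (X ω)) -
        Real.log (condProb p (φ ∘ T) X (φ (T ω)) (X ω)))) := by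
    intro ω
    rcases (hp ω).eq_or_lt with h0 | h0
    · simp [← h0]
    have h4 : condProb p (φ ∘ T) X (φ (T ω)) (X ω) ≠ 0 := (condProb_pos hp (φ ∘ T) X h0).ne'
    rw [Real.log_mul h4 (Real.exp_pos _).ne', Real.log_exp]
    ring
  rw [Finset.sum_congr rfl fun ω _ => h3 ω, Finset.sum_sub_distrib] at h
  have h5 := h.trans (Finset.sum_le_sum fun ω _ => h1 ω)
  rw [← Finset.mul_sum] at h5
  linarith

end Refinement

/-! ### The abstract forgery argument. -/

section Forgery

variable {Ω τ σ A B Z : Type*} [Fintype Ω] [Fintype τ] [DecidableEq τ] [DecidableEq σ]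
  [Fintype σ] [Fintype A] [DecidableEq A] [Fintype B] [DecidableEq B] [Fintype Z] [DecidableEq Z]
  (r : A → B → Prop) [∀ a b, Decidable (r a b)]

/-- Suppose that `X z` and `ψ z ∘ T` are never in relation `r`, but that every choice of distinct
`x, z` based on the coarse information `φ ∘ T` has `X x` and `ψ z ∘ T` unrelated with probability at
most `ε`. Then the fine information `T` must decrease the entropy of the `X z` noticeably. -/
lemma one_le_forgery_bound {p : Ω → ℝ} (hp : ∀ ω, 0 ≤ p ω) (hp1 : ∑ ω, p ω = 1) (T : Ω → τ)
    (φ : τ → σ) (ψ : Z → τ → B) (X : Z → Ω → A) (hZ : 2 ≤ Fintype.card Z)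
    (hX : ∀ ω, 0 < p ω → ∀ z, ¬ r (X z ω) (ψ z (T ω))) {ε : ℝ}
    (hpick : ∀ pick : σ → Z × Z, (∀ t, (pick t).1 ≠ (pick t).2) →
      ∑ ω, p ω * (if r (X (pick (φ (T ω))).1 ω) (ψ (pick (φ (T ω))).2 (T ω)) then 0 else 1) ≤ ε)
    {θ : ℝ} (hθ0 : 0 ≤ θ) (hθ : θ ≤ 1) (k : ℕ) {κ : ℝ}
    (hκ : (Fintype.card Z : ℝ)⁻¹ * ∑ z, (condEntropy p (φ ∘ T) (X z) - condEntropy p T (X z)) ≤ κ) :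
    1 ≤ ε + (Fintype.card A : ℝ) ^ k * (Fintype.card Z : ℝ)⁻¹ + κ +
      2 * (θ + 2 * (k * κ + Fintype.card B * (1 - θ) ^ k)) := by
  classical
  have hZ0 : 0 < Fintype.card Z := by omega
  have : Nonempty Z := Fintype.card_pos_iff.1 hZ0
  have hZR : (0 : ℝ) < Fintype.card Z := by exact_mod_cast hZ0
  set N : ℝ := (Fintype.card Z : ℝ)⁻¹ with hN
  have hN0 : 0 < N := inv_pos.2 hZR
  obtain ⟨z₀, z₁, hz01⟩ := Fintype.one_lt_card_iff.1 (by omega : 1 < Fintype.card Z)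
  set μ : Z → σ → A → ℝ := fun z => condProb p (φ ∘ T) (X z) with hμ
  set ν : Z → σ → B → ℝ := fun z => condProb p (φ ∘ T) (ψ z ∘ T) with hν
  set P : σ → ℝ := fun t => ∑ ω with φ (T ω) = t, p ω with hP
  have hw : ∀ t, ∃ w : Z → Z → ℝ, (∀ x z, 0 ≤ w x z) ∧ (∀ x, ∑ z, w x z = N) ∧
      (∀ z, ∑ x, w x z = N) ∧ (P t ≠ 0 → (∑ z, w z z ≤ (Fintype.card A : ℝ) ^ k * N ∧
      ∑ x, ∑ z, w x z * ∑ b, ν z t b * hitProb r (μ x t) b ≤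
        θ + 2 * (N * ∑ z, (k * ∑ b, ν z t b * hitProb r (μ z t) b +
          Fintype.card B * (1 - θ) ^ k)))) := by
    intro t
    by_cases ht : P t = 0
    -- On null fibers the conditional laws are not probability distributions; any coupling with the
    -- right marginals will do there.
    · refine ⟨fun x z => if x = z then N else 0, ?_, ?_, ?_, fun h => absurd ht h⟩
      · intro x z
        dsimp only
        split_ifs
        · exact hN0.le
        · exact le_rfl
      · simp
      · simp
    · obtain ⟨w, h0, h1, h2, h3, h4⟩ := exists_coupling r (μ := fun z => μ z t)
        (ν := fun z => ν z t) (fun z a => condProb_nonneg hp _ _ _ _)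
        (fun z => sum_condProb p (φ ∘ T) (X z) ht) (fun z b => condProb_nonneg hp _ _ _ _)
        (fun z => sum_condProb p (φ ∘ T) (ψ z ∘ T) ht) hθ0 hθ k
      exact ⟨w, h0, h1, h2, fun _ => ⟨h3, h4⟩⟩
  choose w hw0 hwr hwc hwt using hw
  have hPpos : ∀ ω, 0 < p ω → P (φ (T ω)) ≠ 0 := fun ω h =>
    (Finset.sum_pos' (fun _ _ => hp _)
      ⟨ω, Finset.mem_filter.2 ⟨Finset.mem_univ _, rfl⟩, h⟩ : 0 < P (φ (T ω))).ne'
  set D : ℝ := (Fintype.card A : ℝ) ^ k * N with hD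
  -- the average over all pairs
  set bad : Z → Z → Ω → ℝ := fun x z ω => if r (X x ω) (ψ z (T ω)) then 1 else 0 with hbad
  set hit : Z → Z → Ω → ℝ := fun x z ω => hitProb r (μ x (φ (T ω))) (ψ z (T ω)) with hhit
  have hown : ∀ z, ∑ ω, p ω * hit z z ω ≤
      condEntropy p (φ ∘ T) (X z) - condEntropy p T (X z) := fun z =>
    sum_hitProb_le_condEntropy_sub r hp T φ (ψ z) (X z) fun ω hω => hX ω hω z
  -- The hitting probability depends on the fine information only through `ψ z`, which may therefore
  -- be averaged under its coarse conditional law.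
  have htower : ∀ (x z : Z) (f : σ → ℝ), ∑ ω, p ω * (f (φ (T ω)) * hit x z ω) =
      ∑ ω, p ω * (f (φ (T ω)) *
        ∑ b, ν z (φ (T ω)) b * hitProb r (μ x (φ (T ω))) b) := by
    intro x z f
    refine (sum_eq_sum_condProb hp (φ ∘ T) (ψ z ∘ T)
      fun t b => f t * hitProb r (μ x t) b).trans ?_
    refine Finset.sum_congr rfl fun ω _ => ?_
    congr 1
    rw [Finset.mul_sum]
    exact Finset.sum_congr rfl fun b _ => mul_left_comm _ _ _
  have hκ0 : N * ∑ z, ∑ ω, p ω * hit z z ω ≤ κ :=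
    (mul_le_mul_of_nonneg_left (Finset.sum_le_sum fun z _ => hown z) hN0.le).trans hκ
  have hhit_le : ∑ x, ∑ z, ∑ ω, p ω * (w (φ (T ω)) x z * hit x z ω) ≤
      θ + 2 * (k * κ + Fintype.card B * (1 - θ) ^ k) := by
    rw [Finset.sum_congr rfl fun x _ => Finset.sum_congr rfl fun z _ =>
      htower x z fun t => w t x z]
    calc _ = ∑ ω, p ω * ∑ x, ∑ z, (w (φ (T ω)) x z *
          ∑ b, ν z (φ (T ω)) b * hitProb r (μ x (φ (T ω))) b) := by
          rw [Finset.sum_congr rfl fun x _ => Finset.sum_comm, Finset.sum_comm]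
          refine Finset.sum_congr rfl fun ω _ => ?_
          rw [Finset.mul_sum]
          exact Finset.sum_congr rfl fun x _ => (Finset.mul_sum _ _ _).symm
      _ ≤ ∑ ω, p ω * (θ + 2 * (N * ∑ z, (k * ∑ b, ν z (φ (T ω)) b *
            hitProb r (μ z (φ (T ω))) b + Fintype.card B * (1 - θ) ^ k))) := by
          refine Finset.sum_le_sum fun ω _ => ?_
          rcases (hp ω).eq_or_lt with h0 | h0
          · simp [← h0]
          exact mul_le_mul_of_nonneg_left (hwt _ (hPpos ω h0)).2 h0.le
      _ = θ + 2 * (k * (N * ∑ z, ∑ ω, p ω * hit z z ω) + Fintype.card B * (1 - θ) ^ k) := by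
          have h1 : ∀ z, ∑ ω, p ω * hit z z ω =
              ∑ ω, p ω * ∑ b, ν z (φ (T ω)) b * hitProb r (μ z (φ (T ω))) b := fun z => by
            simpa using htower z z fun _ => 1
          have h2 : ∑ z, ∑ ω, p ω * hit z z ω =
              ∑ ω, p ω * ∑ z, ∑ b, ν z (φ (T ω)) b * hitProb r (μ z (φ (T ω))) b := by
            simp only [h1]
            rw [Finset.sum_comm]
            simp only [Finset.mul_sum]
          have h3 : ∀ ω, p ω * (θ + 2 * (N * ∑ z, (k * ∑ b, ν z (φ (T ω)) b *
              hitProb r (μ z (φ (T ω))) b + Fintype.card B * (1 - θ) ^ k))) =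
              p ω * (θ + 2 * (Fintype.card B * (1 - θ) ^ k)) + 2 * (k * N) * (p ω *
              ∑ z, ∑ b, ν z (φ (T ω)) b * hitProb r (μ z (φ (T ω))) b) := fun ω => by
            rw [Finset.sum_add_distrib, Finset.sum_const, Finset.card_univ, nsmul_eq_mul,
              ← Finset.mul_sum]
            have h4 : N * (Fintype.card Z : ℝ) = 1 := inv_mul_cancel₀ hZR.ne'
            linear_combination 2 * p ω * (Fintype.card B * (1 - θ) ^ k) * h4
          rw [Finset.sum_congr rfl fun ω _ => h3 ω, Finset.sum_add_distrib, ← Finset.sum_mul, hp1,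
            ← Finset.mul_sum, h2]
          ring
      _ ≤ _ := by
          have := mul_le_mul_of_nonneg_left hκ0 (Nat.cast_nonneg (α := ℝ) k)
          linarith
  have hbad_le : ∑ x, ∑ z, ∑ ω, p ω * (w (φ (T ω)) x z * bad x z ω) ≤
      κ + 2 * (θ + 2 * (k * κ + Fintype.card B * (1 - θ) ^ k)) := by
    have h1 : ∀ x z, ∑ ω, p ω * (w (φ (T ω)) x z * bad x z ω) ≤ _ := fun x z =>
      sum_hit_le r hp T φ (ψ z) (X x) (fun t => w t x z) fun t => hw0 t x z
    refine (Finset.sum_le_sum fun x _ => Finset.sum_le_sum fun z _ => h1 x z).trans ?_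
    simp only [Finset.sum_add_distrib, ← Finset.mul_sum]
    refine add_le_add ?_ (mul_le_mul_of_nonneg_left hhit_le zero_le_two)
    refine le_trans (le_of_eq ?_) hκ
    rw [Finset.mul_sum]
    refine Finset.sum_congr rfl fun x _ => ?_
    rw [Finset.sum_comm]
    -- The log-ratio does not involve `z`, so summing out the coupling leaves the uniform average of
    -- the entropy losses.
    have h2 : ∀ ω, ∑ z, p ω * (w (φ (T ω)) x z * (Real.log (condProb p T (X x) (T ω) (X x ω)) -
        Real.log (condProb p (φ ∘ T) (X x) (φ (T ω)) (X x ω)))) =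
        N * (p ω * Real.log (condProb p T (X x) (T ω) (X x ω)) -
        p ω * Real.log (condProb p (φ ∘ T) (X x) (φ (T ω)) (X x ω))) := fun ω => by
      rw [← Finset.mul_sum, ← Finset.sum_mul, hwr]
      ring
    rw [Finset.sum_congr rfl fun ω _ => h2 ω, ← Finset.mul_sum, Finset.sum_sub_distrib]
    simp only [condEntropy, Function.comp_apply]
    ring
  -- the best pair for every value of the coarse information
  have hbest : ∀ t, ∃ q : Z × Z, q.1 ≠ q.2 ∧
      ∑ x, ∑ z, ∑ ω with φ (T ω) = t, p ω * (w t x z * (1 - bad x z ω)) - P t * ∑ z, w t z z ≤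
        ∑ ω with φ (T ω) = t, p ω * (1 - bad q.1 q.2 ω) := by
    intro t
    set W : Z × Z → ℝ := fun q => ∑ ω with φ (T ω) = t, p ω * (1 - bad q.1 q.2 ω) with hW
    have hbad1 : ∀ x z ω, bad x z ω ≤ 1 ∧ 0 ≤ bad x z ω := fun x z ω => by
      simp only [hbad]
      split_ifs <;> simp
    obtain ⟨q, hq, hqmax⟩ := (Finset.univ.filter fun q : Z × Z => q.1 ≠ q.2).exists_max_image W
      ⟨(z₀, z₁), Finset.mem_filter.2 ⟨Finset.mem_univ _, hz01⟩⟩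
    have hW0 : 0 ≤ W q := Finset.sum_nonneg fun ω _ =>
      mul_nonneg (hp ω) (by linarith [(hbad1 q.1 q.2 ω).1])
    have hWP : ∀ q, W q ≤ P t := fun q => Finset.sum_le_sum fun ω _ =>
      mul_le_of_le_one_right (hp ω) (by linarith [(hbad1 q.1 q.2 ω).2])
    refine ⟨q, (Finset.mem_filter.1 hq).2, ?_⟩
    -- Pairs with `x = z` are not admissible for the adversary; each is bounded trivially by `w t z
    -- z * P t`, and the diagonal mass of the coupling is small.
    have h1 : ∀ x z, ∑ ω with φ (T ω) = t, p ω * (w t x z * (1 - bad x z ω)) ≤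
        w t x z * W q + (if x = z then w t x z * P t else 0) := by
      intro x z
      have h2 : ∑ ω with φ (T ω) = t, p ω * (w t x z * (1 - bad x z ω)) =
          w t x z * W (x, z) := by
        rw [hW, Finset.mul_sum]
        exact Finset.sum_congr rfl fun ω _ => mul_left_comm _ _ _
      rw [h2]
      by_cases hxz : x = z
      · rw [if_pos hxz]
        have := mul_le_mul_of_nonneg_left (hWP (x, z)) (hw0 t x z)
        have := mul_nonneg (hw0 t x z) hW0
        linarith
      · rw [if_neg hxz, add_zero]
        exact mul_le_mul_of_nonneg_left
          (hqmax (x, z) (Finset.mem_filter.2 ⟨Finset.mem_univ _, hxz⟩)) (hw0 t x z)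
    have h2 := Finset.sum_le_sum fun x (_ : x ∈ Finset.univ) =>
      Finset.sum_le_sum fun z (_ : z ∈ Finset.univ) => h1 x z
    simp only [Finset.sum_add_distrib, ← Finset.sum_mul, hwr, Finset.sum_ite_eq, Finset.mem_univ,
      if_true, Finset.sum_const, Finset.card_univ, nsmul_eq_mul] at h2
    have h3 : (Fintype.card Z : ℝ) * N = 1 := mul_inv_cancel₀ hZR.ne'
    rw [h3, one_mul] at h2
    linarith
  choose pick hpick1 hpick2 using hbest
  have hfin := hpick pick hpick1
  have h1 : ∑ t, ∑ ω with φ (T ω) = t, p ω * (1 - bad (pick t).1 (pick t).2 ω) ≤ ε := by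
    refine le_trans (le_of_eq ?_) hfin
    rw [← Finset.sum_fiberwise Finset.univ (fun ω => φ (T ω))]
    refine Finset.sum_congr rfl fun t _ => Finset.sum_congr rfl fun ω hω => ?_
    rw [(Finset.mem_filter.1 hω).2]
    simp only [hbad]
    split_ifs <;> simp
  have h2 := (Finset.sum_le_sum fun t (_ : t ∈ Finset.univ) => hpick2 t).trans h1
  have h3 : ∑ t, P t * ∑ z, w t z z ≤ D := by
    have hP1 : ∑ t, P t = 1 := by
      rw [← hp1, ← Finset.sum_fiberwise Finset.univ (fun ω => φ (T ω))]
    calc _ ≤ ∑ t, P t * D := Finset.sum_le_sum fun t _ => by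
          by_cases ht : P t = 0
          · simp [ht]
          · exact mul_le_mul_of_nonneg_left (hwt t ht).1 (Finset.sum_nonneg fun _ _ => hp _)
      _ = D := by rw [← Finset.sum_mul, hP1, one_mul]
  have h4 : ∑ t, ∑ x, ∑ z, ∑ ω with φ (T ω) = t, p ω * (w t x z * (1 - bad x z ω)) =
      1 - ∑ x, ∑ z, ∑ ω, p ω * (w (φ (T ω)) x z * bad x z ω) := by
    have h5 : ∀ ω, ∑ x, ∑ z, p ω * (w (φ (T ω)) x z * (1 - bad x z ω)) =
        p ω - ∑ x, ∑ z, p ω * (w (φ (T ω)) x z * bad x z ω) := fun ω => by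
      have h6 : ∑ x, ∑ z, p ω * w (φ (T ω)) x z = p ω := by
        simp only [← Finset.mul_sum, hwr, Finset.sum_const, Finset.card_univ, nsmul_eq_mul]
        rw [mul_inv_cancel₀ hZR.ne', mul_one]
      refine Eq.trans ?_ (congrArg (fun y => y - ∑ x, ∑ z, p ω * (w (φ (T ω)) x z * bad x z ω)) h6)
      simp only [← Finset.sum_sub_distrib]
      exact Finset.sum_congr rfl fun x _ => Finset.sum_congr rfl fun z _ => by ring
    calc _ = ∑ t, ∑ ω with φ (T ω) = t, ∑ x, ∑ z,
          p ω * (w (φ (T ω)) x z * (1 - bad x z ω)) := by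
          refine Finset.sum_congr rfl fun t _ => ?_
          rw [Finset.sum_congr rfl fun x _ => Finset.sum_comm, Finset.sum_comm]
          exact Finset.sum_congr rfl fun ω hω => by rw [(Finset.mem_filter.1 hω).2]
      _ = ∑ ω, ∑ x, ∑ z, p ω * (w (φ (T ω)) x z * (1 - bad x z ω)) :=
          Finset.sum_fiberwise Finset.univ (fun ω => φ (T ω)) _
      _ = _ := by
          rw [Finset.sum_congr rfl fun ω _ => h5 ω, Finset.sum_sub_distrib, hp1]
          congr 1
          rw [Finset.sum_comm]
          exact Finset.sum_congr rfl fun x _ => Finset.sum_comm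
  rw [Finset.sum_sub_distrib, h4] at h2
  linarith

end Forgery

/-! ### Partial information on the labels, and an adversary asking a fixed set of queries. -/

section Mask

variable {V L : Type} [DecidableEq V] [Inhabited L]

/-- The labels of the vertices in `Q`, all other labels being forgotten. -/
def maskLabels (Q : Finset V) (ℓ : V → L) : V → L := fun v => if v ∈ Q then ℓ v else default

lemma maskLabels_of_mem {Q : Finset V} {v : V} (h : v ∈ Q) (ℓ : V → L) :
    maskLabels Q ℓ v = ℓ v := if_pos h

lemma maskLabels_comp {Q Q' : Finset V} (h : Q ⊆ Q') :
    (maskLabels Q ∘ maskLabels Q' : (V → L) → V → L) = maskLabels Q := by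
  funext ℓ v
  by_cases hv : v ∈ Q
  · simp [maskLabels, hv, h hv]
  · simp [maskLabels, hv]

/-- Ask for the labels of all vertices in the list, then declare candidates. -/
def Strategy.ask (pick : (V → L) → V × V) : List V → (V → L) → Strategy V L
  | [], f => .declare (pick f).1 (pick f).2
  | v :: l, f => .query v fun a => Strategy.ask pick l (Function.update f v a)

omit [Inhabited L] in
lemma Strategy.queries_ask (pick : (V → L) → V × V) (l : List V) (f ℓ : V → L) :
    (Strategy.ask pick l f).queries ℓ = l := by
  induction l generalizing f with
  | nil => rfl
  | cons v l ih => simp only [Strategy.ask, Strategy.queries, ih]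

omit [Inhabited L] in
lemma Strategy.candidates_ask (pick : (V → L) → V × V) (l : List V) (f ℓ : V → L) :
    (Strategy.ask pick l f).candidates ℓ = pick fun v => if v ∈ l then ℓ v else f v := by
  induction l generalizing f with
  | nil => simp [Strategy.ask, Strategy.candidates]
  | cons v l ih =>
    simp only [Strategy.ask, Strategy.candidates, ih]
    congr 1
    funext u
    by_cases hu : u ∈ l
    · simp [hu]
    · by_cases huv : u = v
      · subst huv; simp
      · simp [hu, huv]

end Mask

/-! ### From labelling schemes to the forgery bound. -/

namespace LabellingScheme

variable {V : Type} {s : ℕ} [Fintype V] [DecidableEq V]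

/-- The probability of a labelling function, as a real number. -/
noncomputable def weight (S : LabellingScheme V s) (ℓ : V → Label s) : ℝ := (S.encoder ℓ).toReal

omit [Fintype V] [DecidableEq V] in
lemma weight_nonneg (S : LabellingScheme V s) (ℓ : V → Label s) : 0 ≤ S.weight ℓ :=
  ENNReal.toReal_nonneg

lemma sum_weight (S : LabellingScheme V s) : ∑ ℓ, S.weight ℓ = 1 := by
  have h := S.encoder.tsum_coe
  rw [tsum_fintype] at h
  simp only [weight]
  rw [← ENNReal.toReal_sum fun ℓ _ => S.encoder.apply_ne_top ℓ, h, ENNReal.toReal_one]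

/-- Applies resilience to the strategy that asks for all of `Q` and then lets `pick` choose a
non-adjacent pair. The maximum with 0 reflects the truncation in `ENNReal.ofReal`. -/
lemma IsResilient.sum_weight_le {S : LabellingScheme V s} {G : SimpleGraph V} {ε : ℝ}
    (hS : S.IsResilient G ε) (Q : Finset V) (pick : (V → Label s) → V × V)
    (hne : ∀ f, (pick f).1 ≠ (pick f).2) (h1 : ∀ f, (pick f).1 ∉ Q) (h2 : ∀ f, (pick f).2 ∉ Q)
    (hadj : ∀ f, ¬ G.Adj (pick f).1 (pick f).2) :
    ∑ ℓ, S.weight ℓ * (if S.decoder (ℓ (pick (maskLabels Q ℓ)).1) (ℓ (pick (maskLabels Q ℓ)).2)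
      = false then 0 else 1) ≤ max ε 0 := by
  set σ : Strategy V (Label s) := Strategy.ask pick Q.toList default with hσ
  have h := hS (PMF.pure σ)
  rw [forgeryProbability, tsum_eq_single σ fun σ' h' => by rw [PMF.pure_apply, if_neg h', zero_mul],
    PMF.pure_apply, if_pos rfl, one_mul, PMF.toOuterMeasure_apply_fintype] at h
  have h' := ENNReal.toReal_mono ENNReal.ofReal_ne_top h
  rw [ENNReal.toReal_ofReal'] at h'
  refine le_trans (le_of_eq ?_) h'
  rw [ENNReal.toReal_sum fun ℓ _ => ?_]
  · refine Finset.sum_congr rfl fun ℓ _ => ?_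
    have hc : σ.candidates ℓ = pick (maskLabels Q ℓ) := by
      rw [hσ, Strategy.candidates_ask]
      congr 1
      funext v
      simp [maskLabels]
    have hq : σ.queries ℓ = Q.toList := Strategy.queries_ask _ _ _ _
    have hwin : S.Wins G σ ℓ ↔
        S.decoder (ℓ (pick (maskLabels Q ℓ)).1) (ℓ (pick (maskLabels Q ℓ)).2) = true := by
      rw [Wins, hc, hq]
      simp only [Finset.mem_toList, Finset.length_toList, h1, h2, hne, hadj, Correct, iff_false,
        not_not, ne_eq, not_false_eq_true, true_and, and_iff_right_iff_imp]
      intro _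
      -- The query limit holds automatically: `Q` and the two candidates are disjoint sets of
      -- vertices.
      rw [← Finset.card_pair (hne (maskLabels Q ℓ)), ← Finset.card_union_of_disjoint]
      · exact Finset.card_le_univ _
      · simp [h1, h2]
    by_cases hw : S.Wins G σ ℓ
    · rw [Set.indicator_of_mem (by exact hw), hwin.1 hw]
      simp [weight]
    · rw [Set.indicator_of_notMem (by exact hw)]
      rw [hwin, Bool.not_eq_true] at hw
      simp [hw]
  · by_cases hw : S.Wins G σ ℓ
    · rw [Set.indicator_of_mem (by exact hw)]
      exact S.encoder.apply_ne_top ℓ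
    · rw [Set.indicator_of_notMem (by exact hw)]
      exact ENNReal.zero_ne_top

/-- The adversary that reveals the neighbours `y z j` of all the `c z`, one `j` after another, and
stops at a good moment to declare some `c x` and the next neighbour of some other `c z`. -/
lemma IsResilientScheme.one_le {S : LabellingScheme V s} {G : SimpleGraph V} {δ ε : ℝ}
    (hS : S.IsResilientScheme G δ ε) {Z : Type} [Fintype Z] [DecidableEq Z]
    (hZ : 2 ≤ Fintype.card Z) {d : ℕ} (hd : 0 < d) (c : Z → V) (y : Z → Fin d → V)
    (hadj : ∀ z j, G.Adj (c z) (y z j)) (hcy : ∀ x z j, c x ≠ y z j)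
    (hy : ∀ z z' j j', y z j = y z' j' → j = j')
    (hnadj : ∀ x z j, x ≠ z → ¬ G.Adj (c x) (y z j))
    {θ : ℝ} (hθ0 : 0 ≤ θ) (hθ : θ ≤ 1) (k : ℕ) :
    1 ≤ max ε 0 + ((2 : ℝ) ^ s) ^ k * (Fintype.card Z : ℝ)⁻¹ + s / d +
      2 * (θ + 2 * (k * (s / d) + 2 ^ s * (1 - θ) ^ k)) := by
  have hZR : (0 : ℝ) < Fintype.card Z := by exact_mod_cast (by omega : 0 < Fintype.card Z)
  have hdR : (0 : ℝ) < d := by exact_mod_cast hd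
  set Q : ℕ → Finset V := fun i =>
    (Finset.univ.filter fun q : Z × Fin d => q.2.val < i).image fun q => y q.1 q.2 with hQ
  have hQmem : ∀ i v, v ∈ Q i ↔ ∃ z j, j.val < i ∧ y z j = v := fun i v => by
    simp [hQ]
  have hQmono : ∀ i, Q i ⊆ Q (i + 1) := fun i v hv => by
    rw [hQmem] at hv ⊢
    obtain ⟨z, j, hj, h⟩ := hv
    exact ⟨z, j, by omega, h⟩
  set H : ℕ → ℝ := fun i => (Fintype.card Z : ℝ)⁻¹ *
    ∑ z, condEntropy S.weight (maskLabels (Q i)) (fun ℓ => ℓ (c z)) with hH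
  have hH0 : H 0 ≤ s := by
    have hlog : Real.log (Fintype.card (Label s)) ≤ s := by
      have := Real.log_two_lt_d9
      have h0 := Nat.cast_nonneg (α := ℝ) s
      simp only [Fintype.card_fun, Fintype.card_bool, Fintype.card_fin, Nat.cast_pow,
        Nat.cast_ofNat, Real.log_pow]
      nlinarith
    calc H 0 ≤ (Fintype.card Z : ℝ)⁻¹ * ∑ _z : Z, (s : ℝ) :=
          mul_le_mul_of_nonneg_left (Finset.sum_le_sum fun z _ =>
            (condEntropy_le S.weight_nonneg S.sum_weight _ _).trans hlog) (inv_pos.2 hZR).le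
      _ = s := by
          rw [Finset.sum_const, Finset.card_univ, nsmul_eq_mul, ← mul_assoc,
            inv_mul_cancel₀ hZR.ne', one_mul]
  have hHd : 0 ≤ H d := mul_nonneg (inv_pos.2 hZR).le
    (Finset.sum_nonneg fun z _ => condEntropy_nonneg S.weight_nonneg _ _)
  -- The drops telescope to `H 0 - H d ≤ s`, so one of the `d` rounds loses at most the average.
  obtain ⟨i, hi, hdrop⟩ : ∃ i ∈ Finset.range d, H i - H (i + 1) ≤ s / d := by
    refine Finset.exists_le_of_sum_le ⟨0, Finset.mem_range.2 hd⟩ ?_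
    rw [Finset.sum_range_sub', Finset.sum_const, Finset.card_range, nsmul_eq_mul,
      mul_div_cancel₀ _ hdR.ne']
    linarith
  rw [Finset.mem_range] at hi
  have hyQ : ∀ z, y z ⟨i, hi⟩ ∈ Q (i + 1) := fun z => (hQmem _ _).2 ⟨z, ⟨i, hi⟩, by simp, rfl⟩
  have hyQ' : ∀ z, y z ⟨i, hi⟩ ∉ Q i := fun z h => by
    obtain ⟨z', j, hj, h⟩ := (hQmem _ _).1 h
    have := congrArg Fin.val (hy _ _ _ _ h)
    simp only at this
    omega
  have hcQ : ∀ z, c z ∉ Q i := fun z h => by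
    obtain ⟨z', j, -, h⟩ := (hQmem _ _).1 h
    exact hcy _ _ _ h.symm
  have hmask : ∀ ℓ : V → Label s,
      maskLabels (Q i) (maskLabels (Q (i + 1)) ℓ) = maskLabels (Q i) ℓ :=
    fun ℓ => congrFun (maskLabels_comp (hQmono i)) ℓ
  have key := one_le_forgery_bound (fun a b : Label s => S.decoder a b = false) S.weight_nonneg
    S.sum_weight (maskLabels (Q (i + 1))) (maskLabels (Q i)) (fun z t => t (y z ⟨i, hi⟩))
    (fun z ℓ => ℓ (c z)) hZ ?_ (ε := max ε 0) ?_ hθ0 hθ k (κ := s / d) ?_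
  · simpa using key
  · intro ℓ hℓ z
    rw [maskLabels_of_mem (hyQ z), Bool.not_eq_false]
    refine hS.one_sided ℓ ?_ _ _ (hadj z _)
    rw [PMF.mem_support_iff]
    intro h0
    simp [weight, h0] at hℓ
  · intro pick hpick
    simp only [hmask, maskLabels_of_mem (hyQ _)]
    exact hS.resilient.sum_weight_le (Q i)
      (fun f => (c (pick f).1, y (pick f).2 ⟨i, hi⟩)) (fun f => hcy _ _ _) (fun f => hcQ _)
      (fun f => hyQ' _) (fun f => hnadj _ _ _ (hpick f))
  · rw [maskLabels_comp (hQmono i), Finset.sum_sub_distrib, mul_sub]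
    exact hdrop

end LabellingScheme

/-! ### The lower bound for the hypercube. -/

section Hypercube

variable {d : ℕ}

/-- The vertex with the `j`-th coordinate flipped. -/
def flipCoord (v : Fin d → Bool) (j : Fin d) : Fin d → Bool := Function.update v j (!v j)

lemma hammingDist_flipCoord (v : Fin d → Bool) (j : Fin d) :
    hammingDist v (flipCoord v j) = 1 := by
  rw [hammingDist, Finset.card_eq_one]
  refine ⟨j, ?_⟩
  ext i
  refine Finset.mem_filter.trans ?_
  by_cases h : i = j
  · subst h; simp [flipCoord]
  · simp [flipCoord, h]

/-- The repetition code. -/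
def repeatCode {m : ℕ} (hm : 0 < m) (w : Fin m → Bool) : Fin d → Bool :=
  fun j => w ⟨j % m, Nat.mod_lt _ hm⟩

/-- Every letter of the word occurs at least three times, at the positions `a`, `a + m` and `a + 2 *
m`. -/
lemma three_le_hammingDist_repeatCode {m : ℕ} (hm : 0 < m) (hd : 3 * m ≤ d)
    {w w' : Fin m → Bool} (h : w ≠ w') :
    3 ≤ hammingDist (repeatCode hm w : Fin d → Bool) (repeatCode hm w') := by
  obtain ⟨a, ha⟩ := Function.ne_iff.1 h
  have hlt := a.2
  set f : Fin 3 → Fin d := fun t => ⟨a + m * t, by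
    have := t.2
    have : m * t ≤ m * 2 := Nat.mul_le_mul_left m (by omega)
    omega⟩ with hf
  have hinj : Function.Injective f := fun t t' htt => by
    have h1 : (a : ℕ) + m * t = a + m * t' := congrArg Fin.val htt
    exact Fin.ext (Nat.eq_of_mul_eq_mul_left hm (by omega))
  calc 3 = (Finset.univ.image f).card := by
        rw [Finset.card_image_of_injective _ hinj, Finset.card_univ, Fintype.card_fin]
    _ ≤ _ := Finset.card_le_card fun j hj => by
        obtain ⟨t, -, rfl⟩ := Finset.mem_image.1 hj
        have h2 : (⟨(f t : ℕ) % m, Nat.mod_lt _ hm⟩ : Fin m) = a := by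
          apply Fin.ext
          simp only [hf, Nat.add_mul_mod_self_left]
          exact Nat.mod_eq_of_lt hlt
        refine Finset.mem_filter.2 ⟨Finset.mem_univ _, ?_⟩
        simp only [repeatCode, h2]
        exact ha

/-- Distance 3 between codewords is what is needed: a neighbour of one codeword is neither a
codeword nor adjacent to another one, and it determines both the codeword and the flipped
coordinate. -/
lemma LabellingScheme.IsResilientScheme.hypercube_one_le {s : ℕ}
    {S : LabellingScheme (Fin d → Bool) s} {δ ε : ℝ} (hS : S.IsResilientScheme (hypercube d) δ ε)
    (hd : 3 ≤ d) {θ : ℝ} (hθ0 : 0 ≤ θ) (hθ : θ ≤ 1) (k : ℕ) :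
    1 ≤ max ε 0 + ((2 : ℝ) ^ s) ^ k * ((2 : ℝ) ^ (d / 3))⁻¹ + s / d +
      2 * (θ + 2 * (k * (s / d) + 2 ^ s * (1 - θ) ^ k)) := by
  have hm : 0 < d / 3 := by omega
  have hdm : 3 * (d / 3) ≤ d := by omega
  have hflip : ∀ (v : Fin d → Bool) j, hammingDist (flipCoord v j) v = 1 := fun v j => by
    rw [hammingDist_comm, hammingDist_flipCoord]
  have hfar : ∀ w w' : Fin (d / 3) → Bool,
      hammingDist (repeatCode hm w : Fin d → Bool) (repeatCode hm w') < 3 → w = w' := by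
    intro w w' h
    by_contra hne
    exact absurd (three_le_hammingDist_repeatCode hm hdm hne) (by omega)
  have h := hS.one_le (Z := Fin (d / 3) → Bool) ?_ (by omega : 0 < d) (repeatCode hm)
    (fun z j => flipCoord (repeatCode hm z) j) ?_ ?_ ?_ ?_ hθ0 hθ k
  · simpa using h
  · simp only [Fintype.card_fun, Fintype.card_bool, Fintype.card_fin]
    exact Nat.le_self_pow hm.ne' 2
  · exact fun z j => hammingDist_flipCoord _ _
  · intro x z j hxz
    have h1 := hflip (repeatCode hm z) j
    rw [← hxz] at h1
    have := hfar x z (by omega)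
    subst this
    simp at h1
  · intro z z' j j' hzz
    have h1 := hammingDist_flipCoord (repeatCode hm z) j
    have h2 := hflip (repeatCode hm z') j'
    rw [← hzz] at h2
    have h3 := hammingDist_triangle (repeatCode hm z : Fin d → Bool)
      (flipCoord (repeatCode hm z) j) (repeatCode hm z')
    have := hfar z z' (by omega)
    subst this
    by_contra hjj
    have := congrFun hzz j
    simp [flipCoord, hjj] at this
  · intro x z j hxz hadj
    have h1 : hammingDist (repeatCode hm x : Fin d → Bool) (flipCoord (repeatCode hm z) j) = 1 :=
      hadj
    have h2 := hflip (repeatCode hm z) j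
    have h3 := hammingDist_triangle (repeatCode hm x : Fin d → Bool)
      (flipCoord (repeatCode hm z) j) (repeatCode hm z)
    exact hxz (hfar x z (by omega))

/-- With empty labels the decoder is constant: one-sidedness on an edge forces the value `true`,
which is always wrong on the pair `u, u`. -/
lemma LabellingScheme.IsResilientScheme.hypercube_pos {s : ℕ}
    {S : LabellingScheme (Fin d → Bool) s} {δ ε : ℝ} (hS : S.IsResilientScheme (hypercube d) δ ε)
    (hδ : δ < 1) (hd : 0 < d) : 0 < s := by
  by_contra hs
  obtain rfl : s = 0 := by omega
  set u : Fin d → Bool := fun _ => false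
  have h := hS.sketch u u
  have hne : {ℓ | S.Correct (hypercube d) ℓ u u}.Nonempty := by
    by_contra hemp
    rw [Set.not_nonempty_iff_eq_empty] at hemp
    rw [hemp, MeasureTheory.measure_empty, nonpos_iff_eq_zero, ENNReal.ofReal_eq_zero] at h
    linarith
  obtain ⟨ℓ, hℓ⟩ := hne
  obtain ⟨ℓ', hℓ'⟩ := S.encoder.support_nonempty
  have h1 := hS.one_sided ℓ' hℓ' u (flipCoord u ⟨0, hd⟩) (hammingDist_flipCoord _ _)
  rw [Subsingleton.elim (ℓ' u) (ℓ u), Subsingleton.elim (ℓ' _) (ℓ u)] at h1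
  exact (hypercube d).irrefl (hℓ.1 h1)

/-- Resilient labels for the hypercube have size `Ω(√d)`. -/
theorem hypercube_label_size_ge {ε : ℝ} (hε : ε < 1) :
    ∃ c : ℝ, 0 < c ∧ ∀ δ : ℝ, δ < 1 → ∀ (d s : ℕ) (S : LabellingScheme (Fin d → Bool) s),
      S.IsResilientScheme (hypercube d) δ ε → c * Real.sqrt d ≤ s := by
  obtain ⟨η, hη, hη0, hη1⟩ : ∃ η : ℝ, max ε 0 = 1 - η ∧ 0 < η ∧ η ≤ 1 :=
    ⟨1 - max ε 0, by ring, by linarith [max_lt hε one_pos], by linarith [le_max_right ε 0]⟩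
  -- With `θ = η / 16`, taking `k = K * s` samples makes `2 ^ s * (1 - θ) ^ k = (2 * (1 - θ) ^ K) ^
  -- s` small for all `s ≥ 1`.
  obtain ⟨K₀, hK₀⟩ := exists_pow_lt_of_lt_one (show 0 < η / 64 by positivity)
    (show 1 - η / 16 < 1 by linarith)
  set K := K₀ + 1 with hKdef
  have hK : 2 * (1 - η / 16) ^ K ≤ η / 32 := by
    have h0 : 0 ≤ (1 - η / 16) ^ K₀ := pow_nonneg (by linarith) _
    rw [hKdef, pow_succ]
    nlinarith
  have hK1 : (1 : ℝ) ≤ K := by rw [hKdef]; push_cast; linarith [Nat.cast_nonneg (α := ℝ) K₀]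
  set a : ℝ := η / (32 * K) with ha
  have ha0 : 0 < a := by positivity
  have haK : K * a = η / 32 := by rw [ha]; field_simp
  have ha1 : a ≤ η / 32 := by nlinarith
  refine ⟨Real.sqrt a, Real.sqrt_pos.2 ha0, fun δ hδ d s S hS => ?_⟩
  rcases Nat.eq_zero_or_pos d with rfl | hd
  · simp
  by_contra! hlt
  have hs := hS.hypercube_pos hδ hd
  have hs1 : (1 : ℝ) ≤ s := by exact_mod_cast hs
  have hdR : (0 : ℝ) < d := by exact_mod_cast hd
  rw [← Real.sqrt_mul ha0.le] at hlt
  have hsq : (s : ℝ) ^ 2 < a * d := (Real.lt_sqrt (by linarith)).1 hlt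
  -- Since `s ≥ 1`, the assumption `s ^ 2 < a * d` already excludes small `d`.
  have hdη : 32 ≤ η * d := by nlinarith
  have hd32 : (32 : ℝ) ≤ d := by nlinarith
  have hd3 : 3 ≤ d := by
    have : 32 ≤ d := by exact_mod_cast hd32
    omega
  have hκ : (s : ℝ) / d ≤ η / 32 := by
    rw [div_le_iff₀ hdR]
    nlinarith
  have hKκ : ((K * s : ℕ) : ℝ) * (s / d) ≤ η / 32 := by
    push_cast
    rw [← mul_div_assoc, div_le_iff₀ hdR]
    nlinarith
  have hfail : (2 : ℝ) ^ s * (1 - η / 16) ^ (K * s) ≤ η / 32 := by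
    rw [pow_mul, ← mul_pow]
    refine le_trans (pow_le_of_le_one ?_ (by linarith) hs.ne') hK
    exact mul_nonneg zero_le_two (pow_nonneg (by linarith) _)
  have hm : (d : ℝ) ≤ 3 * ((d / 3 : ℕ) : ℝ) + 2 := by
    exact_mod_cast (by omega : d ≤ 3 * (d / 3) + 2)
  have hexp : (s : ℝ) * (K * s) + 4 / η ≤ ((d / 3 : ℕ) : ℝ) := by
    have h1 : (s : ℝ) * (K * s) ≤ d / 32 := by nlinarith
    have h2 : 4 / η ≤ d / 8 := by
      rw [div_le_div_iff₀ hη0 (by norm_num)]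
      linarith
    linarith
  have hdiag : ((2 : ℝ) ^ s) ^ (K * s) * ((2 : ℝ) ^ (d / 3))⁻¹ ≤ η / 4 := by
    have h4 : (0 : ℝ) < 4 / η := by positivity
    obtain ⟨n, hn⟩ : ∃ n, d / 3 = s * (K * s) + n := by
      refine Nat.exists_eq_add_of_le ?_
      have : ((s * (K * s) : ℕ) : ℝ) ≤ ((d / 3 : ℕ) : ℝ) := by push_cast; linarith
      exact_mod_cast this
    have hn4 : 4 / η ≤ (2 : ℝ) ^ n := by
      rw [hn] at hexp
      push_cast at hexp
      have : (n : ℝ) ≤ (2 : ℝ) ^ n := by exact_mod_cast Nat.lt_two_pow_self.le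
      linarith
    rw [hn, ← pow_mul, pow_add, mul_inv, ← mul_assoc, mul_inv_cancel₀ (by positivity), one_mul]
    calc ((2 : ℝ) ^ n)⁻¹ ≤ (4 / η)⁻¹ := inv_anti₀ h4 hn4
      _ = η / 4 := inv_div _ _
  -- The error terms add up to at most `21 * η / 32`, which is less than `η`.
  have := hS.hypercube_one_le hd3 (θ := η / 16) (by positivity) (by linarith) (K * s)
  linarith

end Hypercube

/-! ### Resampling, and strategies that ignore unqueried labels. -/

section Resampling

variable {V I : Type*} [Fintype V] [DecidableEq V] [Fintype I]

/-- Resampling one coordinate does not change the average. -/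
lemma sum_sum_update (F : (V → I) → ℕ) (v : V) :
    ∑ ω, ∑ a, F (Function.update ω v a) = Fintype.card I * ∑ ω, F ω := by
  have h : ∑ q : (V → I) × I, F (Function.update q.1 v q.2) = ∑ q : (V → I) × I, F q.1 := by
    -- Exchanging the fresh value with the old coordinate is an involution.
    refine Finset.sum_nbij' (fun q => (Function.update q.1 v q.2, q.1 v))
      (fun q => (Function.update q.1 v q.2, q.1 v)) (by simp) (by simp) ?_ ?_ (by simp) <;>
    · rintro ⟨ω, a⟩ -
      simp
  rw [Fintype.sum_prod_type, Fintype.sum_prod_type] at h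
  rw [h]
  simp only [Finset.sum_const, Finset.card_univ, smul_eq_mul, ← Finset.mul_sum]

end Resampling

namespace Strategy

variable {V L : Type}

/-- A strategy only depends on the labels that it asks for. -/
lemma queries_candidates_congr (σ : Strategy V L) {ℓ ℓ' : V → L}
    (h : ∀ v ∈ σ.queries ℓ, ℓ' v = ℓ v) :
    σ.queries ℓ' = σ.queries ℓ ∧ σ.candidates ℓ' = σ.candidates ℓ := by
  induction σ with
  | declare x y => exact ⟨rfl, rfl⟩
  | query x next ih =>
    simp only [queries, List.mem_cons, forall_eq_or_imp] at h
    obtain ⟨h1, h2⟩ := ih (ℓ x) h.2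
    simp only [queries, candidates, h.1, h1, h2, and_self]

end Strategy

/-! ### Resilience from private coins. -/

section PrivateCoins

variable {V I : Type} {s : ℕ} [Fintype V] [DecidableEq V] [Fintype I]

/-- If every vertex draws its own private coins, then querying other vertices does not help. -/
lemma card_wins_le (lab : V → I → Label s) (dec : Label s → Label s → Bool)
    {q : ℕ} (σ : Strategy V (Label s)) [Nonempty I] (Bad : V → V → Prop) [∀ x y, Decidable (Bad x y)]
    (hdec : ∀ x y, x ≠ y → Bad x y →
      q * ∑ a, ∑ b, (if dec (lab x a) (lab y b) = true then 1 else 0) ≤ Fintype.card I ^ 2)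
    (W : Finset (V → I))
    (hW : ∀ ω ∈ W, ∃ x y, σ.candidates (fun u => lab u (ω u)) = (x, y) ∧ x ≠ y ∧
      x ∉ σ.queries (fun u => lab u (ω u)) ∧ y ∉ σ.queries (fun u => lab u (ω u)) ∧
      Bad x y ∧ dec (lab x (ω x)) (lab y (ω y)) = true) :
    q * W.card ≤ Fintype.card (V → I) := by
  classical
  set P : V → V → (V → I) → Prop := fun x y ω => σ.candidates (fun u => lab u (ω u)) = (x, y) ∧
      x ∉ σ.queries (fun u => lab u (ω u)) ∧ y ∉ σ.queries (fun u => lab u (ω u)) with hP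
  -- Ending with `x, y` as unqueried candidates is an event that does not depend on the coins of `x`
  -- and `y`, so these may be resampled.
  have hPcongr : ∀ x y ω ω', (∀ v, v ≠ x → v ≠ y → ω' v = ω v) → P x y ω → P x y ω' := by
    rintro x y ω ω' h ⟨h1, h2, h3⟩
    obtain ⟨h4, h5⟩ := σ.queries_candidates_congr (ℓ := fun u => lab u (ω u))
      (ℓ' := fun u => lab u (ω' u)) fun v hv => by
        rw [h v (fun hx => h2 (hx ▸ hv)) fun hy => h3 (hy ▸ hv)]
    exact ⟨h5.trans h1, by rwa [h4], by rwa [h4]⟩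
  have hPupd : ∀ x y ω a b, P x y (Function.update (Function.update ω x a) y b) ↔ P x y ω := by
    intro x y ω a b
    have h : ∀ v, v ≠ x → v ≠ y → Function.update (Function.update ω x a) y b v = ω v :=
      fun v hx hy => by rw [Function.update_of_ne hy, Function.update_of_ne hx]
    exact ⟨hPcongr x y _ _ fun v hx hy => (h v hx hy).symm, hPcongr x y _ _ h⟩
  have hI : 0 < Fintype.card I := Fintype.card_pos
  set F : V → V → (V → I) → ℕ := fun x y ω =>
    if x ≠ y ∧ Bad x y ∧ P x y ω ∧ dec (lab x (ω x)) (lab y (ω y)) = true then 1 else 0 with hF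
  have hpair : ∀ x y, q * ∑ ω, F x y ω ≤ ∑ ω, if P x y ω then 1 else 0 := by
    intro x y
    by_cases hxy : x ≠ y ∧ Bad x y
    · have h1 : Fintype.card I * (Fintype.card I * ∑ ω, F x y ω) =
          ∑ ω, (if P x y ω then 1 else 0) *
            ∑ a, ∑ b, (if dec (lab x a) (lab y b) = true then 1 else 0) := by
        rw [← sum_sum_update (F x y) y, ← sum_sum_update _ x]
        refine Finset.sum_congr rfl fun ω _ => ?_
        rw [Finset.mul_sum]
        refine Finset.sum_congr rfl fun a _ => ?_
        rw [Finset.mul_sum]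
        refine Finset.sum_congr rfl fun b _ => ?_
        simp only [hF, hPupd, hxy, Function.update_self, Function.update_of_ne hxy.1, true_and,
          ne_eq, not_false_eq_true]
        by_cases hPω : P x y ω <;> simp [hPω]
      have h2 : Fintype.card I ^ 2 * (q * ∑ ω, F x y ω) ≤
          Fintype.card I ^ 2 * ∑ ω, if P x y ω then 1 else 0 := by
        calc _ = q * (Fintype.card I * (Fintype.card I * ∑ ω, F x y ω)) := by ring
          _ = ∑ ω, (if P x y ω then 1 else 0) *
            (q * ∑ a, ∑ b, (if dec (lab x a) (lab y b) = true then 1 else 0)) := by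
              rw [h1, Finset.mul_sum]
              exact Finset.sum_congr rfl fun ω _ => mul_left_comm _ _ _
          _ ≤ ∑ ω, (if P x y ω then 1 else 0) * Fintype.card I ^ 2 :=
              Finset.sum_le_sum fun ω _ => Nat.mul_le_mul_left _ (hdec x y hxy.1 hxy.2)
          _ = _ := by rw [← Finset.sum_mul, mul_comm]
      exact Nat.le_of_mul_le_mul_left h2 (by positivity)
    · have : ∀ ω, F x y ω = 0 := fun ω => if_neg fun h => hxy ⟨h.1, h.2.1⟩
      simp [this]
  have hcount : W.card ≤ ∑ x, ∑ y, ∑ ω, F x y ω := by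
    rw [Finset.sum_congr rfl fun x _ => Finset.sum_comm, Finset.sum_comm, Finset.card_eq_sum_ones]
    refine (Finset.sum_le_sum fun ω hω => ?_).trans
      (Finset.sum_le_sum_of_subset (Finset.subset_univ W))
    obtain ⟨x, y, h1, h2, h3, h4, h5, h6⟩ := hW ω hω
    have h7 : F x y ω = 1 := if_pos ⟨h2, h5, ⟨h1, h3, h4⟩, h6⟩
    rw [← h7]
    exact (Finset.single_le_sum (f := fun y => F x y ω) (fun _ _ => Nat.zero_le _)
      (Finset.mem_univ y)).trans (Finset.single_le_sum (f := fun x => ∑ y, F x y ω)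
      (fun _ _ => Nat.zero_le _) (Finset.mem_univ x))
  calc q * W.card ≤ q * ∑ x, ∑ y, ∑ ω, F x y ω := Nat.mul_le_mul_left _ hcount
    _ ≤ ∑ x, ∑ y, ∑ ω, if P x y ω then 1 else 0 := by
        simp only [Finset.mul_sum]
        refine Finset.sum_le_sum fun x _ => Finset.sum_le_sum fun y _ => ?_
        rw [← Finset.mul_sum]
        exact hpair x y
    _ ≤ ∑ _ω : V → I, 1 := by
        rw [Finset.sum_congr rfl fun x _ => Finset.sum_comm, Finset.sum_comm]
        refine Finset.sum_le_sum fun ω _ => ?_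
        -- The events `P x y` are disjoint, as each `ω` determines the candidates.
        obtain ⟨⟨x₀, y₀⟩, h0⟩ : ∃ c, σ.candidates (fun u => lab u (ω u)) = c := ⟨_, rfl⟩
        rw [Finset.sum_eq_single x₀, Finset.sum_eq_single y₀]
        · split_ifs <;> simp
        · intro y _ hy
          exact if_neg fun h => hy (congrArg Prod.snd (h0.symm.trans h.1)).symm
        · simp
        · intro x _ hx
          exact Finset.sum_eq_zero fun y _ =>
            if_neg fun h => hx (congrArg Prod.fst (h0.symm.trans h.1)).symm
        · simp
    _ = Fintype.card (V → I) := by simp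

variable [Nonempty I]

/-- The labelling scheme in which every vertex computes its label from its own private coins. -/
noncomputable def privateCoinScheme (lab : V → I → Label s) (dec : Label s → Label s → Bool) :
    LabellingScheme V s where
  decoder := dec
  encoder := (PMF.uniformOfFintype (V → I)).map fun ω u => lab u (ω u)

lemma privateCoinScheme_toOuterMeasure (lab : V → I → Label s) (dec : Label s → Label s → Bool)
    (p : (V → Label s) → Prop) [DecidablePred fun ω : V → I => p fun u => lab u (ω u)] :
    (privateCoinScheme lab dec).encoder.toOuterMeasure {ℓ | p ℓ} =
      ENNReal.ofReal ((Finset.univ.filter fun ω : V → I => p fun u => lab u (ω u)).card /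
        Fintype.card (V → I)) := by
  classical
  rw [privateCoinScheme, PMF.toOuterMeasure_map_apply, PMF.toOuterMeasure_uniformOfFintype_apply,
    ENNReal.ofReal_div_of_pos (by exact_mod_cast Fintype.card_pos), ENNReal.ofReal_natCast,
    ENNReal.ofReal_natCast, ← Fintype.card_subtype]
  congr 2
  exact Fintype.card_congr (Equiv.refl _)

/-- Private coins turn a one-sided adjacency protocol into a resilient scheme. -/
lemma privateCoinScheme_isResilientScheme {G : SimpleGraph V} (lab : V → I → Label s)
    (dec : Label s → Label s → Bool) {q : ℕ} (hq : 0 < q)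
    (hadj : ∀ u v a b, G.Adj u v → dec (lab u a) (lab v b) = true)
    (hself : ∀ u a, dec (lab u a) (lab u a) = false)
    (hnadj : ∀ u v, u ≠ v → ¬ G.Adj u v →
      q * ∑ a, ∑ b, (if dec (lab u a) (lab v b) = true then 1 else 0) ≤ Fintype.card I ^ 2)
    {δ ε : ℝ} (hδ : 1 / (q : ℝ) ≤ δ) (hε : 1 / (q : ℝ) ≤ ε) :
    (privateCoinScheme lab dec).IsResilientScheme G δ ε := by
  classical
  set S := privateCoinScheme lab dec with hS
  have hqR : (0 : ℝ) < q := by exact_mod_cast hq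
  have hΩ : (0 : ℝ) < Fintype.card (V → I) := by exact_mod_cast Fintype.card_pos
  have hwins : ∀ σ : Strategy V (Label s), ∀ W : Finset (V → I),
      (∀ ω ∈ W, (σ.candidates fun u => lab u (ω u)).1 ≠ (σ.candidates fun u => lab u (ω u)).2 ∧
        (σ.candidates fun u => lab u (ω u)).1 ∉ (σ.queries fun u => lab u (ω u)) ∧
        (σ.candidates fun u => lab u (ω u)).2 ∉ (σ.queries fun u => lab u (ω u)) ∧
        ¬ S.Correct G (fun u => lab u (ω u)) (σ.candidates fun u => lab u (ω u)).1
          (σ.candidates fun u => lab u (ω u)).2) →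
      (W.card : ℝ) / Fintype.card (V → I) ≤ 1 / q := by
    intro σ W hW
    have h := card_wins_le lab dec (q := q) σ (fun x y => ¬ G.Adj x y) hnadj W ?_
    · rw [div_le_div_iff₀ hΩ hqR, one_mul, mul_comm]
      exact_mod_cast h
    · intro ω hω
      obtain ⟨h1, h2, h3, h4⟩ := hW ω hω
      have h5 : ¬ G.Adj (σ.candidates fun u => lab u (ω u)).1
          (σ.candidates fun u => lab u (ω u)).2 := fun h =>
        h4 (iff_of_true (hadj _ _ _ _ h) h)
      refine ⟨_, _, rfl, h1, h2, h3, h5, ?_⟩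
      by_contra h6
      exact h4 (iff_of_false h6 h5)
  refine ⟨fun u v => ?_, ?_, fun A => ?_⟩
  · rw [hS, privateCoinScheme_toOuterMeasure lab dec fun ℓ => S.Correct G ℓ u v]
    refine ENNReal.ofReal_le_ofReal ?_
    have hsum := Finset.card_filter_add_card_filter_not (s := (Finset.univ : Finset (V → I)))
      (fun ω => S.Correct G (fun w => lab w (ω w)) u v)
    have hwrong : ((Finset.univ.filter fun ω : V → I =>
        ¬ S.Correct G (fun w => lab w (ω w)) u v).card : ℝ) / Fintype.card (V → I) ≤ 1 / q := by
      -- A vertex compared with itself uses the same coins twice, so independence is unavailable and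
      -- `hself` is used. Distinct vertices are handled by the adversary that declares them without
      -- any query.
      by_cases huv : u = v
      · subst huv
        have : ∀ ω : V → I, S.Correct G (fun w => lab w (ω w)) u u := fun ω =>
          iff_of_false (by rw [Bool.not_eq_true]; exact hself u (ω u)) G.irrefl
        simp [this]
      · refine hwins (.declare u v) _ fun ω hω => ⟨huv, ?_, ?_, (Finset.mem_filter.1 hω).2⟩ <;>
          simp [Strategy.queries]
    rw [Finset.card_univ] at hsum
    have hsum' : ((Finset.univ.filter fun ω : V → I =>
        S.Correct G (fun w => lab w (ω w)) u v).card : ℝ) / Fintype.card (V → I) +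
        ((Finset.univ.filter fun ω : V → I =>
        ¬ S.Correct G (fun w => lab w (ω w)) u v).card : ℝ) / Fintype.card (V → I) = 1 := by
      rw [← add_div, div_eq_one_iff_eq hΩ.ne']
      exact_mod_cast hsum
    linarith
  · intro ℓ hℓ u v huv
    obtain ⟨ω, -, rfl⟩ := (PMF.mem_support_map_iff _ _ _).1 hℓ
    exact hadj _ _ _ _ huv
  · have h : ∀ σ, S.encoder.toOuterMeasure {ℓ | S.Wins G σ ℓ} ≤ ENNReal.ofReal ε := fun σ => by
      rw [hS, privateCoinScheme_toOuterMeasure lab dec fun ℓ => S.Wins G σ ℓ]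
      refine ENNReal.ofReal_le_ofReal (le_trans ?_ hε)
      exact hwins σ _ fun ω hω => (Finset.mem_filter.1 hω).2.2
    calc S.forgeryProbability G A ≤ ∑' σ, A σ * ENNReal.ofReal ε :=
          ENNReal.tsum_le_tsum fun σ => mul_le_mul_right (h σ) (A σ)
      _ = ENNReal.ofReal ε := by rw [ENNReal.tsum_mul_right, A.tsum_coe, one_mul]

end PrivateCoins

/-! ### Testing for Hamming weight 1 by random bucketing. -/

section Buckets

variable {d k : ℕ}

/-- The sums of the coordinates of `z` in the buckets given by `g`. -/
def bucketSums (g : Fin d → Fin k) (z : Fin d → ZMod 2) : Fin k → ZMod 2 :=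
  ∑ i, Pi.single (g i) (z i)

lemma bucketSums_sub (g : Fin d → Fin k) (z z' : Fin d → ZMod 2) :
    bucketSums g (z - z') = bucketSums g z - bucketSums g z' := by
  simp only [bucketSums, Pi.sub_apply, Pi.single_sub, Finset.sum_sub_distrib]

lemma bucketSums_update_left {i : Fin d} {z : Fin d → ZMod 2} (hz : z i = 1) (g : Fin d → Fin k)
    (c : Fin k) : bucketSums (Function.update g i c) z =
      bucketSums g (Function.update z i 0) + Pi.single c 1 := by
  rw [bucketSums, bucketSums, ← Finset.add_sum_erase _ _ (Finset.mem_univ i),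
    ← Finset.add_sum_erase Finset.univ (fun j => Pi.single (g j) _) (Finset.mem_univ i)]
  simp only [Function.update_self, hz, Pi.single_zero, zero_add]
  rw [add_comm]
  congr 1
  refine Finset.sum_congr rfl fun j hj => ?_
  have hj' := Finset.ne_of_mem_erase hj
  rw [Function.update_of_ne hj', Function.update_of_ne hj']

lemma zmod_two_eq_one {x : ZMod 2} (hx : x ≠ 0) : x = 1 := by
  revert x; decide

lemma hammingNorm_bucketSums_single (g : Fin d → Fin k) {z : Fin d → ZMod 2}
    (hz : hammingNorm z = 1) : hammingNorm (bucketSums g z) = 1 := by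
  obtain ⟨i, hi⟩ := Finset.card_eq_one.1 hz
  have h : ∀ j, z j ≠ 0 ↔ j = i := fun j => by
    have := Finset.ext_iff.1 hi j
    simpa using this
  have h1 : bucketSums g z = Pi.single (g i) 1 := by
    rw [bucketSums, Finset.sum_eq_single i]
    · rw [zmod_two_eq_one ((h i).2 rfl)]
    · intro j _ hj
      rw [not_not.1 (mt (h j).1 hj), Pi.single_zero]
    · simp
  rw [h1]
  refine Finset.card_eq_one.2 ⟨g i, ?_⟩
  ext j
  by_cases hj : j = g i
  · simp [hj]
  · simp [hj]

/-- With all other coordinates already placed, at most one bucket for a nonzero coordinate cancels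
the remaining sums. -/
lemma sum_bucketSums_eq_zero_le {z : Fin d → ZMod 2} (hz : z ≠ 0) :
    k * ∑ g : Fin d → Fin k, (if bucketSums g z = 0 then 1 else 0) ≤ k ^ d := by
  obtain ⟨i, hi⟩ := Function.ne_iff.1 hz
  have h := sum_sum_update (fun g : Fin d → Fin k => if bucketSums g z = 0 then 1 else 0) i
  rw [Fintype.card_fin] at h
  rw [← h]
  have h1 : ∀ g : Fin d → Fin k,
      ∑ c, (if bucketSums (Function.update g i c) z = 0 then 1 else 0) ≤ 1 := fun g => by
    simp only [bucketSums_update_left (zmod_two_eq_one hi)]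
    rw [← Finset.card_filter, Finset.card_le_one]
    intro c hc c' hc'
    have h2 := (Finset.mem_filter.1 hc).2.trans (Finset.mem_filter.1 hc').2.symm
    have h3 := congrFun (add_left_cancel h2) c
    by_contra hne
    simp [Pi.single_eq_of_ne hne] at h3
  refine (Finset.sum_le_sum fun g _ => h1 g).trans ?_
  simp

/-- Vectors of Hamming norm different from `1` rarely have bucket sums of Hamming norm `1`. -/
lemma sum_hammingNorm_bucketSums_le {z : Fin d → ZMod 2} (hz : hammingNorm z ≠ 1) :
    k * ∑ g : Fin d → Fin k, (if hammingNorm (bucketSums g z) = 1 then 1 else 0) ≤ 3 * k ^ d := by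
  by_cases hz0 : z = 0
  · have : ∀ g : Fin d → Fin k, bucketSums g z = 0 := fun g => by simp [bucketSums, hz0]
    simp [this]
  obtain ⟨i, hi⟩ := Function.ne_iff.1 hz0
  set z' := Function.update z i 0 with hz'
  have hz'0 : z' ≠ 0 := by
    intro h
    refine hz (Finset.card_eq_one.2 ⟨i, ?_⟩)
    ext j
    by_cases hj : j = i
    · subst hj; simpa using hi
    · have := congrFun h j
      rw [hz', Function.update_of_ne hj] at this
      simp [hj, this]
  have h := sum_sum_update
    (fun g : Fin d → Fin k => if hammingNorm (bucketSums g z) = 1 then 1 else 0) i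
  rw [Fintype.card_fin] at h
  rw [← h]
  have h1 : ∀ g : Fin d → Fin k,
      ∑ c, (if hammingNorm (bucketSums (Function.update g i c) z) = 1 then 1 else 0) ≤
        k * (if bucketSums g z' = 0 then 1 else 0) + 2 := fun g => by
    -- Only the bucket `c` of coordinate `i` is resampled. If the rest contributes `p ≠ 0`, weight 1
    -- forces `p` to be a difference of two unit vectors, and `c` to be one of these two positions.
    -- The case `p = 0` is rare by `sum_bucketSums_eq_zero_le`.
    simp only [bucketSums_update_left (zmod_two_eq_one hi), ← hz']
    set p := bucketSums g z' with hp
    rw [← Finset.card_filter]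
    by_cases hp0 : p = 0
    · rw [if_pos hp0, mul_one]
      exact (Finset.card_le_univ _).trans (by simp)
    rw [if_neg hp0, mul_zero, zero_add]
    by_contra! hcard
    obtain ⟨c, hc⟩ := Finset.card_pos.1 (by omega :
      0 < (Finset.univ.filter fun c => hammingNorm (p + Pi.single c 1) = 1).card)
    have hform : ∀ c, hammingNorm (p + Pi.single c 1) = 1 →
        ∃ c', p = Pi.single c' 1 - Pi.single c 1 := by
      intro c hc
      obtain ⟨c', hc'⟩ := Finset.card_eq_one.1 hc
      refine ⟨c', eq_sub_of_add_eq ?_⟩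
      funext j
      have h2 := Finset.ext_iff.1 hc' j
      simp only [Finset.mem_filter, Finset.mem_univ, true_and, Finset.mem_singleton] at h2
      by_cases hj : j = c'
      · rw [zmod_two_eq_one (h2.2 hj), hj, Pi.single_eq_same]
      · rw [not_not.1 (mt h2.1 hj), Pi.single_eq_of_ne hj]
    obtain ⟨c', hpc⟩ := hform c (Finset.mem_filter.1 hc).2
    have hsub : (Finset.univ.filter fun c => hammingNorm (p + Pi.single c 1) = 1) ⊆ {c, c'} := by
      intro e he
      obtain ⟨e', hpe⟩ := hform e (Finset.mem_filter.1 he).2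
      rw [Finset.mem_insert, Finset.mem_singleton]
      by_contra! hne
      have h3 : p e = 0 := by
        rw [hpc, Pi.sub_apply, Pi.single_eq_of_ne hne.2, Pi.single_eq_of_ne hne.1, sub_zero]
      rw [hpe, Pi.sub_apply, Pi.single_eq_same] at h3
      by_cases hee : e = e'
      · exact hp0 (by rw [hpe, hee, sub_self])
      · rw [Pi.single_eq_of_ne hee] at h3
        exact absurd h3 (by decide)
    have := (Finset.card_le_card hsub).trans Finset.card_le_two
    omega
  refine (Finset.sum_le_sum fun g _ => h1 g).trans ?_
  rw [Finset.sum_add_distrib, ← Finset.mul_sum]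
  have h2 := sum_bucketSums_eq_zero_le (k := k) hz'0
  have h3 : ∑ _g : Fin d → Fin k, 2 = 2 * k ^ d := by simp [mul_comm]
  omega

/-- A small family of bucketings that works for all vectors simultaneously. -/
lemma exists_bucketings (d q : ℕ) {T : Type} [Fintype T] [DecidableEq T]
    (hT : d < Fintype.card T) :
    ∃ γ : T → Fin d → Fin (3 * 4 ^ q), ∀ z : Fin d → ZMod 2, hammingNorm z ≠ 1 →
      q * ∑ t, (if hammingNorm (bucketSums (γ t) z) = 1 then 1 else 0) ≤ Fintype.card T := by
  set k := 3 * 4 ^ q with hk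
  have hk0 : 0 < k := by positivity
  set acc : (Fin d → Fin k) → (Fin d → ZMod 2) → ℕ :=
    fun g z => if hammingNorm (bucketSums g z) = 1 then 1 else 0 with hacc
  by_contra! hcon
  -- Exponential moments: acceptance has probability at most `4 ^ (-q)`, so the factor `4 ^ q` for
  -- each acceptance has mean at most 2.
  have h1 : ∀ z : Fin d → ZMod 2, hammingNorm z ≠ 1 →
      ∑ g, (4 ^ q) ^ acc g z ≤ 2 * k ^ d := by
    intro z hz
    have h2 := sum_hammingNorm_bucketSums_le (k := k) hz
    have h3 : 4 ^ q * ∑ g, acc g z ≤ k ^ d := by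
      have : 3 * (4 ^ q * ∑ g, acc g z) ≤ 3 * k ^ d := by
        rw [← mul_assoc, ← hk]; exact h2
      omega
    have h4 : ∀ g, (4 ^ q) ^ acc g z ≤ 1 + 4 ^ q * acc g z := fun g => by
      simp only [hacc]
      split_ifs <;> simp
    refine (Finset.sum_le_sum fun g _ => h4 g).trans ?_
    rw [Finset.sum_add_distrib, ← Finset.mul_sum]
    simp only [Finset.sum_const, Finset.card_univ, Fintype.card_fun, Fintype.card_fin, smul_eq_mul,
      mul_one]
    omega
  have h2 : ∀ z : Fin d → ZMod 2, hammingNorm z ≠ 1 →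
      ∑ γ : T → Fin d → Fin k, 4 ^ (q * ∑ t, acc (γ t) z) ≤ (2 * k ^ d) ^ Fintype.card T := by
    intro z hz
    calc _ = ∑ γ : T → Fin d → Fin k, ∏ t, (4 ^ q) ^ acc (γ t) z := by
          refine Finset.sum_congr rfl fun γ _ => ?_
          rw [Finset.prod_pow_eq_pow_sum, pow_mul]
      _ = (∑ g, (4 ^ q) ^ acc g z) ^ Fintype.card T := by
          rw [← Finset.card_univ, ← Finset.prod_const, Finset.prod_univ_sum, Fintype.piFinset_univ]
      _ ≤ _ := Nat.pow_le_pow_left (h1 z hz) _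
  have h3 : ∀ γ : T → Fin d → Fin k, 4 ^ Fintype.card T ≤
      ∑ z : Fin d → ZMod 2 with hammingNorm z ≠ 1, 4 ^ (q * ∑ t, acc (γ t) z) := by
    intro γ
    obtain ⟨z, hz, hlt⟩ := hcon γ
    exact (Nat.pow_le_pow_right (by norm_num) hlt.le).trans
      (Finset.single_le_sum (f := fun z => 4 ^ (q * ∑ t, acc (γ t) z))
        (fun _ _ => Nat.zero_le _) (Finset.mem_filter.2 ⟨Finset.mem_univ _, hz⟩))
  -- Union bound over the `2 ^ d` vectors: if every family failed, then `4 ^ |T| ≤ 2 ^ d * 2 ^ |T|`,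
  -- contradicting `d < |T|`.
  have h4 : (k ^ d) ^ Fintype.card T * 4 ^ Fintype.card T ≤
      2 ^ d * (2 * k ^ d) ^ Fintype.card T := by
    calc _ = ∑ _γ : T → Fin d → Fin k, 4 ^ Fintype.card T := by simp
      _ ≤ _ := Finset.sum_le_sum fun γ _ => h3 γ
      _ = _ := Finset.sum_comm
      _ ≤ ∑ z : Fin d → ZMod 2 with hammingNorm z ≠ 1, (2 * k ^ d) ^ Fintype.card T :=
          Finset.sum_le_sum fun z hz => h2 z (Finset.mem_filter.1 hz).2
      _ ≤ _ := by
          rw [Finset.sum_const, smul_eq_mul]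
          refine Nat.mul_le_mul_right _ ((Finset.card_le_univ _).trans ?_)
          simp [ZMod.card]
  have h5 : (k ^ d) ^ Fintype.card T * 2 ^ Fintype.card T * 2 ^ Fintype.card T ≤
      (k ^ d) ^ Fintype.card T * 2 ^ Fintype.card T * 2 ^ d := by
    calc _ = (k ^ d) ^ Fintype.card T * 4 ^ Fintype.card T := by
          rw [mul_assoc, ← mul_pow]
          norm_num
      _ ≤ _ := h4
      _ = _ := by rw [mul_pow]; ring
  have h6 := Nat.le_of_mul_le_mul_left h5 (by positivity)
  exact absurd h6 (not_le.2 (Nat.pow_lt_pow_right (by norm_num) hT))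

end Buckets

/-! ### The upper bound for the hypercube. -/

section UpperBound

/-- Bits as elements of the field with two elements. -/
def bitsToZMod {d : ℕ} (u : Fin d → Bool) : Fin d → ZMod 2 := fun i => if u i then 1 else 0

lemma hammingNorm_bitsToZMod_sub {d : ℕ} (u v : Fin d → Bool) :
    hammingNorm (bitsToZMod u - bitsToZMod v) = hammingDist u v := by
  rw [sub_eq_neg_add, ← hammingDist_eq_hammingNorm, hammingDist_comm]
  refine hammingDist_comp (fun _ (b : Bool) => if b then (1 : ZMod 2) else 0) fun _ => ?_
  intro a b
  revert a b
  decide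

/-- Resilient labels of size `s` exist for the hypercube as soon as `s ≥ 2m(3 * 4 ^ q + 1)`. -/
lemma exists_resilient_hypercube {d m q : ℕ} (hq : 0 < q) (hm : d < m * m) {δ ε : ℝ}
    (hδ : 1 / (q : ℝ) ≤ δ) (hε : 1 / (q : ℝ) ≤ ε) :
    ∃ S : LabellingScheme (Fin d → Bool) (2 * m * (3 * 4 ^ q + 1)),
      S.IsResilientScheme (hypercube d) δ ε := by
  have hm0 : 0 < m := Nat.pos_of_ne_zero (by rintro rfl; omega)
  have : Nonempty (Fin m) := ⟨⟨0, hm0⟩⟩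
  obtain ⟨γ, hγ⟩ := exists_bucketings d q (T := Fin m × Fin m) (by simpa using hm)
  generalize 3 * 4 ^ q = k at γ hγ ⊢
  set R := Fin m × (Fin m → Fin k → ZMod 2) with hR
  have hcard : Fintype.card (R × R) ≤ Fintype.card (Label (2 * m * (k + 1))) := by
    simp only [hR, Fintype.card_prod, Fintype.card_fun, Fintype.card_fin, ZMod.card,
      Fintype.card_bool]
    have h1 : m ≤ 2 ^ m := Nat.lt_two_pow_self.le
    have h2 : m * (2 ^ k) ^ m ≤ 2 ^ (m * (k + 1)) := by
      calc m * (2 ^ k) ^ m ≤ 2 ^ m * (2 ^ k) ^ m := Nat.mul_le_mul_right _ h1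
        _ = _ := by rw [← pow_mul, ← pow_add]; congr 1; ring
    calc _ ≤ 2 ^ (m * (k + 1)) * 2 ^ (m * (k + 1)) := Nat.mul_le_mul h2 h2
      _ = _ := by rw [← pow_add]; congr 1; ring
  obtain ⟨e⟩ := Function.Embedding.nonempty_of_card_le hcard
  have : Nonempty (R × R) := ⟨((Classical.arbitrary _, 0), (Classical.arbitrary _, 0))⟩
  set raw : (Fin d → Bool) → Fin m × Fin m → R × R := fun u a =>
    ((a.1, fun j => bucketSums (γ (a.1, j)) (bitsToZMod u)),
      (a.2, fun i => bucketSums (γ (i, a.2)) (bitsToZMod u))) with hraw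
  -- The row of the first label and the column of the second meet in the bucketing at `(a.1, b.2)`;
  -- by linearity both sums together give the bucket sums of the difference.
  set dec : Label (2 * m * (k + 1)) → Label (2 * m * (k + 1)) → Bool := fun x y =>
    decide (hammingNorm ((Function.invFun e x).1.2 (Function.invFun e y).2.1 -
      (Function.invFun e y).2.2 (Function.invFun e x).1.1) = 1) with hdec
  have hdec_eq : ∀ u v a b, dec (e (raw u a)) (e (raw v b)) = true ↔
      hammingNorm (bucketSums (γ (a.1, b.2)) (bitsToZMod u - bitsToZMod v)) = 1 := by
    intro u v a b
    simp only [hdec, Function.leftInverse_invFun e.injective _, decide_eq_true_eq, hraw,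
      bucketSums_sub]
  refine ⟨privateCoinScheme (fun u a => e (raw u a)) dec,
    privateCoinScheme_isResilientScheme _ _ hq ?_ ?_ ?_ hδ hε⟩
  · intro u v a b huv
    rw [hdec_eq]
    refine hammingNorm_bucketSums_single _ ?_
    rw [hammingNorm_bitsToZMod_sub]
    exact huv
  · intro u a
    rw [← Bool.not_eq_true, hdec_eq, sub_self]
    simp [bucketSums]
  · intro u v _ huv
    have h := hγ (bitsToZMod u - bitsToZMod v) (by rw [hammingNorm_bitsToZMod_sub]; exact huv)
    set f : Fin m → Fin m → ℕ := fun i j =>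
      if hammingNorm (bucketSums (γ (i, j)) (bitsToZMod u - bitsToZMod v)) = 1 then 1 else 0
    have hf : ∀ a b, (if dec (e (raw u a)) (e (raw v b)) = true then 1 else 0) = f a.1 b.2 :=
      fun a b => if_congr (hdec_eq u v a b) rfl rfl
    have h' : q * ∑ i, ∑ j, f i j ≤ m * m := by
      simpa only [Fintype.sum_prod_type, Fintype.card_prod, Fintype.card_fin] using h
    simp only [hf, Fintype.sum_prod_type, Finset.sum_const, Finset.card_univ,
      Fintype.card_prod, Fintype.card_fin, smul_eq_mul, ← Finset.mul_sum]
    calc _ = m * m * (q * ∑ i, ∑ j, f i j) := by ring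
      _ ≤ m * m * (m * m) := Nat.mul_le_mul_left _ h'
      _ = _ := by ring

/-- Resilient labels of size `O(√d)` exist for the hypercube. -/
theorem hypercube_label_size_le {δ ε : ℝ} (hδ : 0 < δ) (hε : 0 < ε) :
    ∃ C : ℝ, 0 < C ∧ ∀ d : ℕ, ∃ s : ℕ, (s : ℝ) ≤ C * Real.sqrt d ∧
      ∃ S : LabellingScheme (Fin d → Bool) s, S.IsResilientScheme (hypercube d) δ ε := by
  obtain ⟨n, hn⟩ := exists_nat_one_div_lt (lt_min hδ hε)
  set q := n + 1 with hq
  have hq' : 1 / (q : ℝ) ≤ min δ ε := by rw [hq]; push_cast; exact hn.le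
  refine ⟨4 * ((3 * 4 ^ q + 1 : ℕ) : ℝ), by positivity, fun d => ?_⟩
  rcases Nat.eq_zero_or_pos d with rfl | hd
  -- For `d = 0` the bound forces empty labels; they suffice for a single vertex.
  · refine ⟨0, by simp, privateCoinScheme (I := Unit) (fun _ _ => default) fun _ _ => false,
      privateCoinScheme_isResilientScheme _ _ n.succ_pos ?_ (fun _ _ => rfl) ?_
        (hq'.trans (min_le_left _ _)) (hq'.trans (min_le_right _ _))⟩
    · intro u v _ _ huv
      rw [Subsingleton.elim u v] at huv
      exact absurd huv (hypercube 0).irrefl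
    · intro u v huv
      exact absurd (Subsingleton.elim u v) huv
  · refine ⟨2 * (d.sqrt + 1) * (3 * 4 ^ q + 1), ?_, exists_resilient_hypercube n.succ_pos
      (Nat.lt_succ_sqrt d) (hq'.trans (min_le_left _ _)) (hq'.trans (min_le_right _ _))⟩
    have h1 : (d.sqrt : ℝ) ≤ Real.sqrt d := Real.nat_sqrt_le_real_sqrt
    have h2 : (1 : ℝ) ≤ Real.sqrt d := Real.one_le_sqrt.2 (by exact_mod_cast hd)
    have h3 : (2 * (d.sqrt + 1) : ℝ) ≤ 4 * Real.sqrt d := by linarith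
    have h4 := mul_le_mul_of_nonneg_right h3 (Nat.cast_nonneg (α := ℝ) (3 * 4 ^ q + 1))
    push_cast at h4 ⊢
    linarith

end UpperBound

theorem mainTheorem5 :
    -- labels of size `O(√d)` suffice, for any fixed error and probability of forgery
    (∀ δ ε : ℝ, 0 < δ → 0 < ε →
      ∃ C : ℝ, 0 < C ∧ ∀ d : ℕ, ∃ s : ℕ, (s : ℝ) ≤ C * Real.sqrt d ∧
        ∃ S : LabellingScheme (Fin d → Bool) s, S.IsResilientScheme (hypercube d) δ ε) ∧
    -- labels of size `Ω(√d)` are necessary, for any fixed probability of forgery below `1`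
    (∀ ε : ℝ, ε < 1 →
      ∃ c : ℝ, 0 < c ∧ ∀ δ : ℝ, δ < 1 → ∀ (d s : ℕ) (S : LabellingScheme (Fin d → Bool) s),
        S.IsResilientScheme (hypercube d) δ ε → c * Real.sqrt d ≤ s) :=
  ⟨fun _ _ => hypercube_label_size_le, fun _ => hypercube_label_size_ge⟩
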